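/- Call finite groups $G$ and $H$ \emph{similar} if, writing $G=P_1\times\cdots\times P_c\times\widetilde G$ and $H=Q_1\times\cdots\times Q_d\times\widetilde H$, where $P_1,\dots,P_c$ (resp. $Q_1,\dots,Q_d$) are all the nontrivial cyclic central Sylow subgroups of $G$ (resp. $H$), with $|P_i|=p_i^{n_i}$ and $|Q_j|=q_j^{m_j}$ for primes $p_i,q_j$, we have $\widetilde G\cong\widetilde H$, $c=d$, and $n_i=m_i$ for all $i$ after some reordering. Let $\operatorname{Sub}G$ be the set of subgroups of $G$. In the table below $p,q,r,s$ denote arbitrary primes, always assumed distinct from each other and from the primes dividing the other orders that appear in the same entry. **Theorem.** Let $1\le k\le 22$. Every abelian group with exactly $k$ subgroups is finite. For each choice of the arbitrary primes, every group listed in row $k$ has exactly $k$ subgroups. Each entry describes a single similarity class, whatever the choice of the primes, and different entries of a row describe different classes. An abelian group $G$ satisfies $|\operatorname{Sub}G|=k$ if and only if it is finite and similar to a group listed in row $k$. The number of similarity classes of finite abelian groups with exactly $k$ subgroups is the number in the last column. $$\begin{array}{c|l|c} k=|\operatorname{Sub}G| & \text{Similarity classes} & \#\\ \hline 1 & \{e\}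 & 1\\ 2 & \mathbb{Z}_p & 1\\ 3 & \mathbb{Z}_{p^2} & 1\\ 4 & \mathbb{Z}_{p^3},\ \mathbb{Z}_{pq} & 2\\ 5 & \mathbb{Z}_{p^4},\ \mathbb{Z}_2\times\mathbb{Z}_2 & 2\\ 6 & \mathbb{Z}_{p^5},\ \mathbb{Z}_{p^2q},\ \mathbb{Z}_3\times\mathbb{Z}_3 & 3\\ 7 & \mathbb{Z}_{p^6} & 1\\ 8 & \mathbb{Z}_{p^7},\ \mathbb{Z}_{p^3q},\ \mathbb{Z}_{pqr},\ \mathbb{Z}_4\times\mathbb{Z}_2,\ \mathbb{Z}_5\times\mathbb{Z}_5 & 5\\ 9 & \mathbb{Z}_{p^8},\ \mathbb{Z}_{p^2q^2} & 2\\ 10 & \mathbb{Z}_{p^9},\ \mathbb{Z}_{p^4q},\ \mathbb{Z}_2\times\mathbb{Z}_2\times\mathbb{Z}_p,\ \mathbb{Z}_9\times\mathbb{Z}_3,\ \mathbb{Z}_7\times\mathbb{Z}_7 & 5\\ 11 & \mathbb{Z}_{p^{10}},\ \mathbb{Z}_8\times\mathbb{Z}_2 & 2\\ 12 & \mathbb{Z}_{p^{11}},\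 \mathbb{Z}_{p^5q},\ \mathbb{Z}_{p^3q^2},\ \mathbb{Z}_{p^2qr},\ \mathbb{Z}_3\times\mathbb{Z}_3\times\mathbb{Z}_p & 5\\ 13 & \mathbb{Z}_{p^{12}} & 1\\ 14 & \mathbb{Z}_{p^{13}},\ \mathbb{Z}_{p^6q},\ \mathbb{Z}_{16}\times\mathbb{Z}_2,\ \mathbb{Z}_{27}\times\mathbb{Z}_3,\ \mathbb{Z}_{25}\times\mathbb{Z}_5,\ \mathbb{Z}_{11}\times\mathbb{Z}_{11} & 6\\ 15 & \mathbb{Z}_{p^{14}},\ \mathbb{Z}_{p^4q^2},\ \mathbb{Z}_4\times\mathbb{Z}_4,\ \mathbb{Z}_2\times\mathbb{Z}_2\times\mathbb{Z}_{p^2} & 4\\ 16 & \mathbb{Z}_{p^{15}},\ \mathbb{Z}_{p^7q},\ \mathbb{Z}_{p^3q^3},\ \mathbb{Z}_{p^3qr},\ \mathbb{Z}_{pqrs},\ \mathbb{Z}_2\times\mathbb{Z}_2\times\mathbb{Z}_2,\ \mathbb{Z}_4\times\mathbb{Z}_2\times\mathbb{Z}_p,\ \mathbb{Z}_5\times\mathbb{Z}_5\times\mathbb{Z}_p,\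 \mathbb{Z}_{13}\times\mathbb{Z}_{13} & 9\\ 17 & \mathbb{Z}_{p^{16}},\ \mathbb{Z}_{32}\times\mathbb{Z}_2 & 2\\ 18 & \mathbb{Z}_{p^{17}},\ \mathbb{Z}_{p^8q},\ \mathbb{Z}_{p^5q^2},\ \mathbb{Z}_{p^2q^2r},\ \mathbb{Z}_{81}\times\mathbb{Z}_3,\ \mathbb{Z}_3\times\mathbb{Z}_3\times\mathbb{Z}_{p^2},\ \mathbb{Z}_{49}\times\mathbb{Z}_7 & 7\\ 19 & \mathbb{Z}_{p^{18}} & 1\\ 20 & \mathbb{Z}_{p^{19}},\ \mathbb{Z}_{p^9q},\ \mathbb{Z}_{p^4q^3},\ \mathbb{Z}_{p^4qr},\ \mathbb{Z}_{64}\times\mathbb{Z}_2,\ \mathbb{Z}_2\times\mathbb{Z}_2\times\mathbb{Z}_{p^3},\ \mathbb{Z}_2\times\mathbb{Z}_2\times\mathbb{Z}_{pq},\ \mathbb{Z}_9\times\mathbb{Z}_3\times\mathbb{Z}_p,\ \mathbb{Z}_{125}\times\mathbb{Z}_5,\ \mathbb{Z}_7\times\mathbb{Z}_7\times\mathbb{Z}_p,\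 \mathbb{Z}_{17}\times\mathbb{Z}_{17} & 11\\ 21 & \mathbb{Z}_{p^{20}},\ \mathbb{Z}_{p^6q^2} & 2\\ 22 & \mathbb{Z}_{p^{21}},\ \mathbb{Z}_{p^{10}q},\ \mathbb{Z}_8\times\mathbb{Z}_4,\ \mathbb{Z}_8\times\mathbb{Z}_2\times\mathbb{Z}_p,\ \mathbb{Z}_{243}\times\mathbb{Z}_3,\ \mathbb{Z}_{19}\times\mathbb{Z}_{19} & 6 \end{array}$$ -/

import Mathlib

namespace SubgroupCount

universe u v

/-- The primes `p` dividing `|G|` for which the finite group `G` has a Sylow `p`-subgroup that is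
cyclic and central. Such a Sylow subgroup is nontrivial and is the only Sylow `p`-subgroup of `G`,
so these primes index the cyclic central Sylow subgroups `P₁, …, P_c` of `G`. -/
def cyclicCentralPrimes (G : Type u) [Group G] : Set ℕ :=
  {p | p.Prime ∧ p ∣ Nat.card G ∧
    ∃ P : Sylow p G, IsCyclic (P : Subgroup G) ∧ (P : Subgroup G) ≤ Subgroup.center G}

/-- The subgroup `P₁ × ⋯ × P_c` of `G` generated by all its cyclic central Sylow subgroups. -/
def cyclicCentralPart (G : Type u) [Group G] : Subgroup G :=
  ⨆ p ∈ cyclicCentralPrimes G, ⨆ P : Sylow p G, (P : Subgroup G)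

/-- Similarity of finite groups. Write `G = P₁ × ⋯ × P_c × K` and `H = Q₁ × ⋯ × Q_d × L`, where
the `P_i` and the `Q_j` are the cyclic central Sylow subgroups of `G` and of `H`; then `G` and `H`
are similar if `K ≅ L`, `c = d` and, after a reordering, the exponents `n_i`, `m_i` in
`|P_i| = p_i ^ n_i`, `|Q_i| = q_i ^ m_i` agree.

The subgroup `P₁ × ⋯ × P_c` is central, so a complement `K` in the lattice of subgroups
is the same as an internal direct factorization of `G`. The exponent of `|P_i|` is that of `p_i` in
the factorization of `|G|`, since `P_i` is a Sylow subgroup. -/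
def IsSimilar (G : Type u) [Group G] (H : Type v) [Group H] : Prop :=
  (∃ (K : Subgroup G) (L : Subgroup H),
    IsCompl (cyclicCentralPart G) K ∧ IsCompl (cyclicCentralPart H) L ∧ Nonempty (K ≃* L)) ∧
  ∃ e : cyclicCentralPrimes G ≃ cyclicCentralPrimes H,
    ∀ p : cyclicCentralPrimes G,
      (Nat.card G).factorization (p : ℕ) = (Nat.card H).factorization (e p : ℕ)

/-- An entry of the table: `⟨[m₁, …, m_r], [a₁, …, a_s]⟩` is the family of the groups
`ℤ_{m₁} × ⋯ × ℤ_{m_r} × ℤ_{p₁^{a₁} ⋯ p_s^{a_s}}`, with arbitrary distinct primes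
`p₁, …, p_s` that are coprime to `m₁, …, m_r`. -/
structure Entry where
  /-- the orders of the fixed cyclic factors -/
  moduli : List ℕ
  /-- the exponents of the arbitrary primes -/
  exponents : List ℕ

/-- The primes `p i` are an allowed choice of the arbitrary primes in the entry `t`. -/
def Entry.Admissible (t : Entry) (p : Fin t.exponents.length → ℕ) : Prop :=
  (∀ i, (p i).Prime) ∧ Function.Injective p ∧ ∀ i, ∀ m ∈ t.moduli, (p i).Coprime m

/-- The group of the entry `t` for the choice `p` of primes, written multiplicatively. -/
abbrev Entry.Rep (t : Entry) (p : Fin t.exponents.length → ℕ) : Type :=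
  Multiplicative
    ((∀ j : Fin t.moduli.length, ZMod (t.moduli.get j)) ×
      ZMod (∏ i, p i ^ t.exponents.get i))

/-- The table: the similarity classes listed for each number `k` of subgroups. -/
def table : ℕ → List Entry
  | 1 => [⟨[], []⟩]
  | 2 => [⟨[], [1]⟩]
  | 3 => [⟨[], [2]⟩]
  | 4 => [⟨[], [3]⟩, ⟨[], [1, 1]⟩]
  | 5 => [⟨[], [4]⟩, ⟨[2, 2], []⟩]
  | 6 => [⟨[], [5]⟩, ⟨[], [2, 1]⟩, ⟨[3, 3], []⟩]
  | 7 => [⟨[], [6]⟩]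
  | 8 => [⟨[], [7]⟩, ⟨[], [3, 1]⟩, ⟨[], [1, 1, 1]⟩, ⟨[4, 2], []⟩, ⟨[5, 5], []⟩]
  | 9 => [⟨[], [8]⟩, ⟨[], [2, 2]⟩]
  | 10 => [⟨[], [9]⟩, ⟨[], [4, 1]⟩, ⟨[2, 2], [1]⟩, ⟨[9, 3], []⟩, ⟨[7, 7], []⟩]
  | 11 => [⟨[], [10]⟩, ⟨[8, 2], []⟩]
  | 12 => [⟨[], [11]⟩, ⟨[], [5, 1]⟩, ⟨[], [3, 2]⟩, ⟨[], [2, 1, 1]⟩, ⟨[3, 3], [1]⟩]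
  | 13 => [⟨[], [12]⟩]
  | 14 => [⟨[], [13]⟩, ⟨[], [6, 1]⟩, ⟨[16, 2], []⟩, ⟨[27, 3], []⟩, ⟨[25, 5], []⟩,
      ⟨[11, 11], []⟩]
  | 15 => [⟨[], [14]⟩, ⟨[], [4, 2]⟩, ⟨[4, 4], []⟩, ⟨[2, 2], [2]⟩]
  | 16 => [⟨[], [15]⟩, ⟨[], [7, 1]⟩, ⟨[], [3, 3]⟩, ⟨[], [3, 1, 1]⟩, ⟨[], [1, 1, 1, 1]⟩,
      ⟨[2, 2, 2], []⟩, ⟨[4, 2], [1]⟩, ⟨[5, 5], [1]⟩, ⟨[13, 13], []⟩]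
  | 17 => [⟨[], [16]⟩, ⟨[32, 2], []⟩]
  | 18 => [⟨[], [17]⟩, ⟨[], [8, 1]⟩, ⟨[], [5, 2]⟩, ⟨[], [2, 2, 1]⟩, ⟨[81, 3], []⟩,
      ⟨[3, 3], [2]⟩, ⟨[49, 7], []⟩]
  | 19 => [⟨[], [18]⟩]
  | 20 => [⟨[], [19]⟩, ⟨[], [9, 1]⟩, ⟨[], [4, 3]⟩, ⟨[], [4, 1, 1]⟩, ⟨[64, 2], []⟩,
      ⟨[2, 2], [3]⟩, ⟨[2, 2], [1, 1]⟩, ⟨[9, 3], [1]⟩, ⟨[125, 5], []⟩, ⟨[7, 7], [1]⟩,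
      ⟨[17, 17], []⟩]
  | 21 => [⟨[], [20]⟩, ⟨[], [6, 2]⟩]
  | 22 => [⟨[], [21]⟩, ⟨[], [10, 1]⟩, ⟨[8, 4], []⟩, ⟨[8, 2], [1]⟩, ⟨[243, 3], []⟩,
      ⟨[19, 19], []⟩]
  | _ => []

/-- The last column of the table: the number of similarity classes. -/
def classCount : ℕ → ℕ
  | 1 => 1
  | 2 => 1
  | 3 => 1
  | 4 => 2
  | 5 => 2
  | 6 => 3
  | 7 => 1
  | 8 => 5
  | 9 => 2
  | 10 => 5
  | 11 => 2
  | 12 => 5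
  | 13 => 1
  | 14 => 6
  | 15 => 4
  | 16 => 9
  | 17 => 2
  | 18 => 7
  | 19 => 1
  | 20 => 11
  | 21 => 2
  | 22 => 6
  | _ => 0

/-- The finite abelian groups with exactly `k` subgroups. -/
structure FinAbGroupWith (k : ℕ) where
  carrier : Type
  [commGroup : CommGroup carrier]
  [finite : Finite carrier]
  card_subgroup : Nat.card (Subgroup carrier) = k

attribute [instance] FinAbGroupWith.commGroup FinAbGroupWith.finite

/-- The set of similarity classes of finite abelian groups with exactly `k` subgroups. -/
def similarityClasses (k : ℕ) : Set (Set (FinAbGroupWith k)) :=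
  {C | ∃ G : FinAbGroupWith k, C = {H | IsSimilar G.carrier H.carrier}}

end SubgroupCount

/-! A finite abelian group splits as `M × C` with `C` cyclic, `|M|` and `|C|` coprime, and no
nontrivial Sylow subgroup of `M` cyclic. The factor `C` is the product of the cyclic Sylow
subgroups, so the similarity class amounts to the isomorphism type of `M` together with the multiset
of exponents `aᵢ` in the factorization of `|C|` (`isSimilar_iff`). Coprimality makes the number of
subgroups multiplicative: it is `|Sub M| · ∏ (aᵢ + 1)`.

It remains to find all `M` with at most `22` subgroups (`exists_mem_smallTypes`). Goursat's lemma
counts the subgroups of `A × B` by homomorphisms `X → B / Y`, which gives `∑ p ^ min i j` for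
`ℤ_{p^a} × ℤ_{p^b}` and a closed formula for `ℤ_{p^a} × ℤ_p × ℤ_p`. A quotient has no more subgroups
than the group, so a few small quotients limit `M`: two primes force at least `5 · 6` subgroups, and
in rank at least three only `ℤ_2 ^ 3` survives. In rank two both the prime and the exponents are
bounded.

For each such `M` the possible exponents are the factorizations of `k / |Sub M|` into factors at
least `2`. Comparing these with the table is a finite check (`table_spec`, `table_complete`). -/

namespace SubgroupCount

universe u v

/-! ### Goursat's lemma and subgroups of direct products. -/

section Goursat

variable {A B : Type*} [AddCommGroup A] [AddCommGroup B]

/-- The subgroup of `A × B` consisting of the pairs `(a, b)` with `a ∈ X` and `φ a = b + Y`. -/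
def goursatSubgroup (s : Σ (X : AddSubgroup A) (Y : AddSubgroup B), X →+ B ⧸ Y) :
    AddSubgroup (A × B) where
  carrier := {z | ∃ h : z.1 ∈ s.1, s.2.2 ⟨z.1, h⟩ = (z.2 : B ⧸ s.2.1)}
  zero_mem' := ⟨s.1.zero_mem, s.2.2.map_zero⟩
  add_mem' := by
    rintro ⟨a, b⟩ ⟨a', b'⟩ ⟨h, e⟩ ⟨h', e'⟩
    refine ⟨s.1.add_mem h h', ?_⟩
    have := s.2.2.map_add ⟨a, h⟩ ⟨a', h'⟩
    rw [e, e'] at this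
    exact this
  neg_mem' := by
    rintro ⟨a, b⟩ ⟨h, e⟩
    refine ⟨s.1.neg_mem h, ?_⟩
    have := s.2.2.map_neg ⟨a, h⟩
    rw [e] at this
    exact this

theorem mem_goursatSubgroup {s : Σ (X : AddSubgroup A) (Y : AddSubgroup B), X →+ B ⧸ Y} {a : A}
    {b : B} : (a, b) ∈ goursatSubgroup s ↔ ∃ h : a ∈ s.1, s.2.2 ⟨a, h⟩ = (b : B ⧸ s.2.1) :=
  Iff.rfl

theorem goursatSubgroup_injective :
    Function.Injective (goursatSubgroup (A := A) (B := B)) := by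
  rintro ⟨X, Y, φ⟩ ⟨X', Y', φ'⟩ h
  have key : ∀ (a : A) (b : B), (∃ h : a ∈ X, φ ⟨a, h⟩ = (b : B ⧸ Y)) ↔
      ∃ h : a ∈ X', φ' ⟨a, h⟩ = (b : B ⧸ Y') := fun a b => by
    exact SetLike.ext_iff.1 h (a, b)
  have hX : X = X' := by
    ext a
    constructor
    · intro ha
      obtain ⟨b, hb⟩ := QuotientAddGroup.mk_surjective (φ ⟨a, ha⟩)
      exact ((key a b).1 ⟨ha, hb.symm⟩).1
    · intro ha
      obtain ⟨b, hb⟩ := QuotientAddGroup.mk_surjective (φ' ⟨a, ha⟩)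
      exact ((key a b).2 ⟨ha, hb.symm⟩).1
  subst hX
  -- `Y` is the fibre of the subgroup over `0`.
  have hY : Y = Y' := by
    ext b
    have h0 := key 0 b
    have e : (⟨0, X.zero_mem⟩ : X) = 0 := rfl
    simp only [X.zero_mem, exists_true_left, e, map_zero, eq_comm (a := (0 : B ⧸ _)),
      QuotientAddGroup.eq_zero_iff] at h0
    exact h0
  subst hY
  have hφ : φ = φ' := by
    ext ⟨a, ha⟩
    obtain ⟨b, hb⟩ := QuotientAddGroup.mk_surjective (φ ⟨a, ha⟩)
    obtain ⟨_, h2⟩ := (key a b).1 ⟨ha, hb.symm⟩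
    rw [h2, ← hb]
  rw [hφ]

theorem goursatSubgroup_surjective :
    Function.Surjective (goursatSubgroup (A := A) (B := B)) := by
  intro H
  let X : AddSubgroup A := H.map (AddMonoidHom.fst A B)
  let Y : AddSubgroup B := H.comap (AddMonoidHom.inr A B)
  have hX : ∀ x : X, ∃ b, ((x : A), b) ∈ H := by
    rintro ⟨_, ⟨⟨a, b⟩, h, rfl⟩⟩
    exact ⟨b, h⟩
  choose f hf using hX
  -- The fibre of `H` over `a` is one coset of `Y`, so modulo `Y` the choice of `f` is immaterial
  -- and additive.
  have hY : ∀ {a b b'}, (a, b) ∈ H → ((a, b') ∈ H ↔ (b : B ⧸ Y) = b') := by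
    intro a b b' h
    rw [QuotientAddGroup.eq]
    change _ ↔ ((0 : A), -b + b') ∈ H
    constructor
    · intro h'
      simpa using H.add_mem (H.neg_mem h) h'
    · intro h'
      simpa using H.add_mem h h'
  let φ : X →+ B ⧸ Y := AddMonoidHom.mk' (fun x => (f x : B ⧸ Y)) (by
    intro x y
    rw [← QuotientAddGroup.mk_add]
    exact (hY (hf (x + y))).1 (by simpa using H.add_mem (hf x) (hf y)))
  refine ⟨⟨X, Y, φ⟩, ?_⟩
  ext ⟨a, b⟩
  rw [mem_goursatSubgroup]
  constructor
  · rintro ⟨h, e⟩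
    exact (hY (hf ⟨a, h⟩)).2 e
  · intro h
    have ha : a ∈ X := ⟨(a, b), h, rfl⟩
    exact ⟨ha, (hY (hf ⟨a, ha⟩)).1 h⟩

theorem finite_addMonoidHom [Finite A] [Finite B] : Finite (A →+ B) :=
  Finite.of_injective _ DFunLike.coe_injective

/-- Goursat's lemma as a count: a subgroup of `A × B` amounts to a subgroup `X` of `A`, a subgroup
`Y` of `B` and a homomorphism `X → B / Y`. -/
theorem card_addSubgroup_prod [Finite A] [Finite B] [Fintype (AddSubgroup A)]
    [Fintype (AddSubgroup B)] :
    Nat.card (AddSubgroup (A × B)) =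
      ∑ X : AddSubgroup A, ∑ Y : AddSubgroup B, Nat.card (X →+ B ⧸ Y) := by
  have : ∀ (X : AddSubgroup A) (Y : AddSubgroup B), Finite (X →+ B ⧸ Y) :=
    fun _ _ => finite_addMonoidHom
  rw [← Nat.card_congr (Equiv.ofBijective _
    ⟨goursatSubgroup_injective (A := A) (B := B), goursatSubgroup_surjective⟩), Nat.card_sigma]
  exact Finset.sum_congr rfl fun X _ => Nat.card_sigma

theorem card_addSubgroup_prod_of_coprime [Finite A] [Finite B]
    (h : (Nat.card A).Coprime (Nat.card B)) :
    Nat.card (AddSubgroup (A × B)) = Nat.card (AddSubgroup A) * Nat.card (AddSubgroup B) := by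
  have := Fintype.ofFinite (AddSubgroup A)
  have := Fintype.ofFinite (AddSubgroup B)
  rw [card_addSubgroup_prod]
  have key : ∀ (X : AddSubgroup A) (Y : AddSubgroup B), Nat.card (X →+ B ⧸ Y) = 1 := by
    intro X Y
    rw [Nat.card_eq_one_iff_unique]
    refine ⟨⟨fun f g => ?_⟩, ⟨0⟩⟩
    have h0 : ∀ f : X →+ B ⧸ Y, f = 0 := by
      intro f
      ext x
      have h1 : addOrderOf (f x) ∣ Nat.card A :=
        (addOrderOf_map_dvd f x).trans ((addOrderOf_dvd_natCard x).trans X.card_addSubgroup_dvd_card)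
      have h2 : addOrderOf (f x) ∣ Nat.card B :=
        (addOrderOf_dvd_natCard _).trans Y.card_quotient_dvd_card
      exact AddMonoid.addOrderOf_eq_one_iff.1 (Nat.eq_one_of_dvd_coprimes h h1 h2)
    rw [h0 f, h0 g]
  simp [key, Nat.card_eq_fintype_card]

theorem mul_card_le_card_addSubgroup_prod [Finite A] [Finite B] :
    Nat.card (AddSubgroup A) * Nat.card (AddSubgroup B) ≤ Nat.card (AddSubgroup (A × B)) := by
  rw [← Nat.card_prod]
  refine Nat.card_le_card_of_injective (fun z => z.1.prod z.2) ?_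
  rintro ⟨X, Y⟩ ⟨X', Y'⟩ h
  have key : ∀ a b, (a ∈ X ∧ b ∈ Y) ↔ (a ∈ X' ∧ b ∈ Y') := fun a b => by
    simpa [AddSubgroup.mem_prod] using SetLike.ext_iff.1 h (a, b)
  refine Prod.ext ?_ ?_
  · ext a
    simpa using key a 0
  · ext b
    simpa using key 0 b

/-- The source of all lower bounds: a group with too many subgroups cannot be a quotient of one with
few. -/
theorem card_addSubgroup_le_of_surjective [Finite A] (f : A →+ B) (hf : Function.Surjective f) :
    Nat.card (AddSubgroup B) ≤ Nat.card (AddSubgroup A) :=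
  Nat.card_le_card_of_injective _ (AddSubgroup.comap_injective hf)

theorem card_addSubgroup_congr (e : A ≃+ B) :
    Nat.card (AddSubgroup A) = Nat.card (AddSubgroup B) :=
  Nat.card_congr e.mapAddSubgroup.toEquiv

end Goursat

/-! ### Homomorphisms from cyclic groups and subgroups of cyclic groups. -/

section Cyclic

variable {A B : Type*} [AddCommGroup A] [AddCommGroup B]

/-- A homomorphism is determined by the image of a generator, which may be any element killed by
`|A|`. For infinite `A` the convention `Nat.card A = 0` imposes no condition, as it should. -/
theorem card_addMonoidHom_of_isAddCyclic [IsAddCyclic A] :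
    Nat.card (A →+ B) = Nat.card {b : B // Nat.card A • b = 0} := by
  refine Nat.card_congr ?_
  refine (zmodAddCyclicAddEquiv ‹_›).addMonoidHomCongrLeft.symm.toEquiv.trans ?_
  refine (ZMod.lift _).symm.trans ?_
  exact (zmultiplesHom B).symm.subtypeEquiv fun f => by
    simp [← map_nsmul]

theorem card_torsionBy_of_isAddCyclic [Finite B] [IsAddCyclic B] (d : ℕ) :
    Nat.card {b : B // d • b = 0} = (Nat.card B).gcd d :=
  IsAddCyclic.card_nsmulAddMonoidHom_ker B d

theorem eq_of_card_eq_of_isAddCyclic [Finite A] [IsAddCyclic A] {X Y : AddSubgroup A}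
    (h : Nat.card X = Nat.card Y) : X = Y := by
  -- A subgroup of order `d` lies in the `d`-torsion, which in a cyclic group has only `d` elements.
  have key : ∀ X : AddSubgroup A, X = (nsmulAddMonoidHom (Nat.card X) : A →+ A).ker := by
    intro X
    refine AddSubgroup.eq_of_le_of_card_ge ?_ ?_
    · intro x hx
      have := card_nsmul_eq_zero' (x := (⟨x, hx⟩ : X))
      exact congrArg Subtype.val this
    · rw [IsAddCyclic.card_nsmulAddMonoidHom_ker, Nat.gcd_eq_right X.card_addSubgroup_dvd_card]
  rw [key X, key Y, h]

theorem exists_addSubgroup_card_eq [Finite A] [IsAddCyclic A] {d : ℕ} (h : d ∣ Nat.card A) :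
    ∃ X : AddSubgroup A, Nat.card X = d :=
  ⟨(nsmulAddMonoidHom d : A →+ A).ker, by
    rw [IsAddCyclic.card_nsmulAddMonoidHom_ker, Nat.gcd_eq_right h]⟩

/-- The subgroups of a finite cyclic group correspond to the divisors of its order. -/
theorem sum_addSubgroup_of_isAddCyclic [Finite A] [IsAddCyclic A] [Fintype (AddSubgroup A)]
    (f : ℕ → ℕ) :
    ∑ X : AddSubgroup A, f (Nat.card X) = ∑ d ∈ (Nat.card A).divisors, f d := by
  refine Finset.sum_bij (fun X _ => Nat.card X) ?_ ?_ ?_ ?_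
  · intro X _
    exact Nat.mem_divisors.2 ⟨X.card_addSubgroup_dvd_card, Nat.card_pos.ne'⟩
  · intro X _ Y _ h
    exact eq_of_card_eq_of_isAddCyclic h
  · intro d hd
    obtain ⟨X, hX⟩ := exists_addSubgroup_card_eq (Nat.dvd_of_mem_divisors hd)
    exact ⟨X, Finset.mem_univ _, hX⟩
  · intro _ _
    rfl

theorem card_addSubgroup_of_isAddCyclic [Finite A] [IsAddCyclic A] :
    Nat.card (AddSubgroup A) = (Nat.card A).divisors.card := by
  have := Fintype.ofFinite (AddSubgroup A)
  simpa [Nat.card_eq_fintype_card] using sum_addSubgroup_of_isAddCyclic (A := A) fun _ => 1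

theorem card_addSubgroup_prod_of_isAddCyclic [Finite A] [IsAddCyclic A] [Finite B]
    [Fintype (AddSubgroup B)] :
    Nat.card (AddSubgroup (A × B)) = ∑ d ∈ (Nat.card A).divisors,
      ∑ Y : AddSubgroup B, Nat.card {b : B ⧸ Y // d • b = 0} := by
  have := Fintype.ofFinite (AddSubgroup A)
  rw [card_addSubgroup_prod, ← sum_addSubgroup_of_isAddCyclic (A := A)
    fun d => ∑ Y : AddSubgroup B, Nat.card {b : B ⧸ Y // d • b = 0}]
  refine Finset.sum_congr rfl fun X _ => Finset.sum_congr rfl fun Y _ => ?_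
  exact card_addMonoidHom_of_isAddCyclic

theorem card_addSubgroup_prod_of_isAddCyclic' [Finite A] [IsAddCyclic A] [Finite B]
    [IsAddCyclic B] :
    Nat.card (AddSubgroup (A × B)) = ∑ d ∈ (Nat.card A).divisors,
      ∑ c ∈ (Nat.card B).divisors, c.gcd d := by
  have := Fintype.ofFinite (AddSubgroup B)
  rw [card_addSubgroup_prod_of_isAddCyclic]
  refine Finset.sum_congr rfl fun d _ => ?_
  -- The quotient by `Y` has order `|B| / |Y|`, so the sum is reindexed by complementary divisors.
  rw [← Nat.sum_div_divisors (Nat.card B) fun c => c.gcd d,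
    ← sum_addSubgroup_of_isAddCyclic (A := B) fun c => (Nat.card B / c).gcd d]
  refine Finset.sum_congr rfl fun Y _ => ?_
  have : IsAddCyclic (B ⧸ Y) :=
    isAddCyclic_of_surjective (QuotientAddGroup.mk' Y) (QuotientAddGroup.mk'_surjective Y)
  rw [card_torsionBy_of_isAddCyclic]
  congr 1
  rw [Y.card_eq_card_quotient_mul_card_addSubgroup, Nat.mul_div_cancel _ Nat.card_pos]

end Cyclic

/-! ### Subgroup counts for `p`-groups of rank two and three, and maps between products. -/

/-- The number of subgroups of `ℤ_{p ^ a} × ℤ_{p ^ b}`. -/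
def rankTwoCount (p a b : ℕ) : ℕ :=
  ∑ i ∈ Finset.range (a + 1), ∑ j ∈ Finset.range (b + 1), p ^ min i j

theorem rankTwoCount_mono {p a b p' a' b' : ℕ} (hp : p ≤ p') (ha : a ≤ a')
    (hb : b ≤ b') : rankTwoCount p a b ≤ rankTwoCount p' a' b' := by
  unfold rankTwoCount
  refine (Finset.sum_le_sum fun i _ => Finset.sum_le_sum fun j _ =>
    Nat.pow_le_pow_left hp (min i j)).trans ?_
  refine (Finset.sum_le_sum fun i _ => Finset.sum_le_sum_of_subset
    (Finset.range_mono (Nat.succ_le_succ hb))).trans ?_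
  exact Finset.sum_le_sum_of_subset (Finset.range_mono (Nat.succ_le_succ ha))

theorem sum_divisors_prime_pow {p : ℕ} (hp : p.Prime) (a : ℕ) (f : ℕ → ℕ) :
    ∑ d ∈ (p ^ a).divisors, f d = ∑ i ∈ Finset.range (a + 1), f (p ^ i) := by
  rw [Nat.divisors_prime_pow hp, Finset.sum_map]
  rfl

theorem card_addSubgroup_zmod_prod_zmod {p : ℕ} (hp : p.Prime) (a b : ℕ) :
    Nat.card (AddSubgroup (ZMod (p ^ a) × ZMod (p ^ b))) = rankTwoCount p a b := by
  have h1 : NeZero (p ^ a) := ⟨pow_ne_zero _ hp.ne_zero⟩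
  have h2 : NeZero (p ^ b) := ⟨pow_ne_zero _ hp.ne_zero⟩
  rw [card_addSubgroup_prod_of_isAddCyclic', Nat.card_zmod, Nat.card_zmod,
    sum_divisors_prime_pow hp]
  refine Finset.sum_congr rfl fun i _ => ?_
  rw [sum_divisors_prime_pow hp]
  refine Finset.sum_congr rfl fun j _ => ?_
  rcases le_total i j with h | h
  · rw [min_eq_left h, Nat.gcd_eq_right (pow_dvd_pow p h)]
  · rw [min_eq_right h, Nat.gcd_eq_left (pow_dvd_pow p h)]

theorem card_addSubgroup_zmod (n : ℕ) [NeZero n] :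
    Nat.card (AddSubgroup (ZMod n)) = n.divisors.card := by
  rw [card_addSubgroup_of_isAddCyclic, Nat.card_zmod]

theorem card_addSubgroup_zmod_prime_sq {p : ℕ} (hp : p.Prime) :
    Nat.card (AddSubgroup (ZMod p × ZMod p)) = p + 3 := by
  have := card_addSubgroup_zmod_prod_zmod hp 1 1
  rw [pow_one] at this
  rw [this]
  simp [rankTwoCount, Finset.sum_range_succ]
  omega

/-- Of the `p + 3` subgroups, the zero subgroup contributes `p ^ 2`, the whole group `1`, and each
of the `p + 1` lines `p`. -/
theorem sum_card_quotient_zmod_prime_sq {p : ℕ} (hp : p.Prime)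
    [Fintype (AddSubgroup (ZMod p × ZMod p))] :
    ∑ Y : AddSubgroup (ZMod p × ZMod p), Nat.card ((ZMod p × ZMod p) ⧸ Y) =
      p ^ 2 + (p + 1) * p + 1 := by
  classical
  have : Fact p.Prime := ⟨hp⟩
  have hB : Nat.card (ZMod p × ZMod p) = p ^ 2 := by
    rw [Nat.card_prod, Nat.card_zmod, sq]
  have hmid : ∀ Y ∈ (Finset.univ.erase (⊤ : AddSubgroup (ZMod p × ZMod p))).erase ⊥,
      Nat.card ((ZMod p × ZMod p) ⧸ Y) = p := by
    intro Y hY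
    simp only [Finset.mem_erase, Finset.mem_univ, and_true] at hY
    have h := Y.card_eq_card_quotient_mul_card_addSubgroup
    rw [hB] at h
    obtain ⟨k, hk, hk'⟩ := (Nat.dvd_prime_pow hp).1 (Dvd.intro _ h.symm)
    interval_cases k
    · rw [hk', pow_zero, one_mul, ← hB] at h
      exact absurd (AddSubgroup.eq_top_of_card_eq Y h.symm) hY.2
    · rw [hk', pow_one]
    · rw [hk'] at h
      exact absurd (AddSubgroup.eq_bot_of_card_eq Y
        (Nat.eq_of_mul_eq_mul_left (pow_pos hp.pos 2) (by rw [← h, mul_one]))) hY.1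
  have hne : (⊥ : AddSubgroup (ZMod p × ZMod p)) ≠ ⊤ := bot_ne_top
  have hbot : (⊥ : AddSubgroup (ZMod p × ZMod p)) ∈ Finset.univ.erase ⊤ := by simp
  rw [← Finset.add_sum_erase _ _ (Finset.mem_univ ⊤), ← Finset.add_sum_erase _ _ hbot,
    Finset.sum_congr rfl hmid, Finset.sum_const, Finset.card_erase_of_mem hbot,
    Finset.card_erase_of_mem (Finset.mem_univ _), Finset.card_univ, ← Nat.card_eq_fintype_card,
    card_addSubgroup_zmod_prime_sq hp]
  have e1 : Nat.card ((ZMod p × ZMod p) ⧸ (⊤ : AddSubgroup (ZMod p × ZMod p))) = 1 := by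
    simpa [AddSubgroup.index] using (AddSubgroup.index_top (G := ZMod p × ZMod p))
  have e2 : Nat.card ((ZMod p × ZMod p) ⧸ (⊥ : AddSubgroup (ZMod p × ZMod p))) = p ^ 2 := by
    rw [← hB]
    simpa [AddSubgroup.index] using (AddSubgroup.index_bot (G := ZMod p × ZMod p))
  rw [e1, e2, show p + 3 - 1 - 1 = p + 1 by omega, smul_eq_mul]
  ring

/-- The trivial subgroup of `ZMod (p ^ a)` contributes one homomorphism for each of the `p + 3`
subgroups `Y`. Each of its `a` nontrivial subgroups has order divisible by `p`, which kills the
whole quotient by `Y`, so its contribution is the sum of the quotient orders. -/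
theorem card_addSubgroup_zmod_prime_pow_prod {p : ℕ} (hp : p.Prime) (a : ℕ) :
    Nat.card (AddSubgroup (ZMod (p ^ a) × (ZMod p × ZMod p))) =
      p + 3 + a * (p ^ 2 + (p + 1) * p + 1) := by
  have : Fact p.Prime := ⟨hp⟩
  have := Fintype.ofFinite (AddSubgroup (ZMod p × ZMod p))
  have h1 : NeZero (p ^ a) := ⟨pow_ne_zero _ hp.ne_zero⟩
  have h2 : ∀ Y : AddSubgroup (ZMod p × ZMod p),
      Nat.card {b : (ZMod p × ZMod p) ⧸ Y // p ^ 0 • b = 0} = 1 := by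
    intro Y
    simp
  have h3 : ∀ (i : ℕ) (Y : AddSubgroup (ZMod p × ZMod p)),
      Nat.card {b : (ZMod p × ZMod p) ⧸ Y // p ^ (i + 1) • b = 0} =
        Nat.card ((ZMod p × ZMod p) ⧸ Y) := by
    intro i Y
    refine Nat.card_congr (Equiv.subtypeUnivEquiv fun b => ?_)
    obtain ⟨⟨x, y⟩, rfl⟩ := QuotientAddGroup.mk_surjective b
    rw [← QuotientAddGroup.mk_nsmul, Prod.smul_mk, nsmul_eq_mul, nsmul_eq_mul]
    simp only [pow_succ, Nat.cast_mul, CharP.cast_eq_zero, mul_zero, zero_mul]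
    rfl
  rw [card_addSubgroup_prod_of_isAddCyclic, Nat.card_zmod, sum_divisors_prime_pow hp,
    Finset.sum_range_succ']
  simp only [h2, h3, sum_card_quotient_zmod_prime_sq hp, Finset.sum_const, Finset.card_range,
    Finset.card_univ, ← Nat.card_eq_fintype_card, card_addSubgroup_zmod_prime_sq hp, smul_eq_mul,
    mul_one]
  ring

theorem exists_surjective_zmod_pi {ι κ : Type*} {n : ι → ℕ} {d : κ → ℕ} (f : κ → ι)
    (hf : Function.Injective f) (h : ∀ k, d k ∣ n (f k)) :
    ∃ φ : (∀ i, ZMod (n i)) →+ ∀ k, ZMod (d k), Function.Surjective φ := by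
  classical
  refine ⟨AddMonoidHom.pi fun k =>
    (ZMod.castHom (h k) (ZMod (d k))).toAddMonoidHom.comp (Pi.evalAddMonoidHom _ (f k)), ?_⟩
  intro y
  choose x hx using fun k => ZMod.castHom_surjective (h k) (y k)
  -- Lifts are placed at the coordinates `f k`; injectivity of `f` prevents conflicts, and the other
  -- coordinates are filled with `0`.
  refine ⟨fun i => if hi : ∃ k, f k = i then hi.choose_spec ▸ x hi.choose else 0, ?_⟩
  funext k
  have hi : ∃ k', f k' = f k := ⟨k, rfl⟩
  have key : ∀ (k' : κ) (e : f k' = f k), (e ▸ x k' : ZMod (n (f k))) = x k := by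
    intro k' e
    obtain rfl := hf e
    rfl
  rw [← hx k, ← key hi.choose hi.choose_spec]
  change ZMod.castHom (h k) (ZMod (d k)) (dite _ _ _) = _
  rw [dif_pos hi]

theorem nonempty_addEquiv_zmod_pi {ι κ : Type*} {n : ι → ℕ} {d : κ → ℕ} (σ : κ ≃ ι)
    (h : ∀ k, d k = n (σ k)) : Nonempty ((∀ i, ZMod (n i)) ≃+ ∀ k, ZMod (d k)) := by
  obtain rfl : d = n ∘ σ := funext h
  exact ⟨(LinearEquiv.piCongrLeft ℤ (fun i => ZMod (n i)) σ).symm.toAddEquiv⟩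

theorem card_addSubgroup_fin_two {p : ℕ} (hp : p.Prime) (a b : ℕ) {d : Fin 2 → ℕ}
    (h0 : d 0 = p ^ a) (h1 : d 1 = p ^ b) :
    Nat.card (AddSubgroup (∀ k, ZMod (d k))) = rankTwoCount p a b := by
  rw [← card_addSubgroup_zmod_prod_zmod hp, ← h0, ← h1]
  exact card_addSubgroup_congr (LinearEquiv.piFinTwo ℤ fun k => ZMod (d k)).toAddEquiv

/-- A product of cyclic groups over `n + 1` indices splits off its first factor. -/
theorem nonempty_addEquiv_fin_succ {n : ℕ} (d : Fin (n + 1) → ℕ) :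
    Nonempty ((∀ k, ZMod (d k)) ≃+ ZMod (d 0) × ∀ k : Fin n, ZMod (d k.succ)) :=
  ⟨{ (Fin.consEquiv fun k => ZMod (d k)).symm with map_add' := fun _ _ => rfl }⟩

theorem card_addSubgroup_fin_three {p : ℕ} (hp : p.Prime) (a : ℕ) {d : Fin 3 → ℕ}
    (h0 : d 0 = p ^ a) (h1 : d 1 = p) (h2 : d 2 = p) :
    Nat.card (AddSubgroup (∀ k, ZMod (d k))) = p + 3 + a * (p ^ 2 + (p + 1) * p + 1) := by
  rw [← card_addSubgroup_zmod_prime_pow_prod hp, ← h0]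
  obtain ⟨e⟩ := nonempty_addEquiv_fin_succ d
  have e2 : (∀ k : Fin 2, ZMod (d k.succ)) ≃+ ZMod p × ZMod p := by
    refine (LinearEquiv.piFinTwo ℤ fun k : Fin 2 => ZMod (d k.succ)).toAddEquiv.trans ?_
    change ZMod (d 1) × ZMod (d 2) ≃+ _
    rw [h1, h2]
  exact card_addSubgroup_congr (e.trans ((AddEquiv.refl _).prodCongr e2))

theorem card_addSubgroup_fin_four {d : Fin 4 → ℕ} (h : ∀ k, d k = 2) :
    22 < Nat.card (AddSubgroup (∀ k, ZMod (d k))) := by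
  have : ∀ k, NeZero (d k) := fun k => ⟨by rw [h]; norm_num⟩
  obtain ⟨e⟩ := nonempty_addEquiv_fin_succ d
  rw [card_addSubgroup_congr e]
  refine lt_of_lt_of_le ?_ mul_card_le_card_addSubgroup_prod
  rw [card_addSubgroup_zmod, card_addSubgroup_fin_three Nat.prime_two 1 (by simp [h]) (h _) (h _),
    h, Nat.prime_two.divisors]
  norm_num

/-! ### Multisets of exponents in prime factorizations. -/

section Multisets

/-- Equal multisets of values mean fibres of equal size, and bijections between the fibres glue. -/
theorem exists_equiv_iff_map_univ_eq {α β γ : Type*} [Fintype α] [Fintype β] {f : α → γ}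
    {g : β → γ} : (∃ e : α ≃ β, ∀ x, f x = g (e x)) ↔
      Finset.univ.val.map f = Finset.univ.val.map g := by
  classical
  constructor
  · rintro ⟨e, he⟩
    rw [show f = g ∘ e from funext he, ← Multiset.map_map]
    congr 1
    exact congrArg Finset.val (Finset.map_univ_equiv e)
  · intro h
    have key : ∀ c, Nonempty ({x // f x = c} ≃ {y // g y = c}) := by
      intro c
      rw [← Fintype.card_eq, Fintype.card_subtype, Fintype.card_subtype]
      have := congrArg (Multiset.count c) h
      rw [Multiset.count_map, Multiset.count_map] at this
      simpa [Finset.card_def, eq_comm] using this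
    exact ⟨Equiv.ofFiberEquiv fun c => (key c).some, fun x =>
      (Equiv.ofFiberEquiv_map (fun c => (key c).some) x).symm⟩

/-- The exponents in the prime factorization of `n`. -/
def exponentMultiset (n : ℕ) : Multiset ℕ :=
  n.primeFactors.val.map n.factorization

/-- Shaped after the second half of `IsSimilar`: `f` and `g` will be the exponents in `|G|` and
`|H|`, while `m` and `n` are the orders of the cyclic parts. -/
theorem exists_equiv_iff_exponentMultiset_eq {m n : ℕ} {S T : Set ℕ} {f g : ℕ → ℕ}
    (hS : S = m.primeFactors) (hT : T = n.primeFactors)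
    (hf : ∀ p ∈ S, f p = m.factorization p) (hg : ∀ p ∈ T, g p = n.factorization p) :
    (∃ e : S ≃ T, ∀ p : S, f p = g (e p)) ↔ exponentMultiset m = exponentMultiset n := by
  subst hS hT
  have key : ∀ (k : ℕ) (f : ℕ → ℕ), (∀ p ∈ (k.primeFactors : Set ℕ), f p = k.factorization p) →
      Finset.univ.val.map (fun p : (k.primeFactors : Set ℕ) => f p) = exponentMultiset k := by
    intro k f hf
    rw [exponentMultiset, show (fun p : (k.primeFactors : Set ℕ) => f p) =
      k.factorization ∘ Subtype.val from funext fun p => hf p p.2, ← Multiset.map_map]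
    congr 1
    exact congrArg Finset.val (Finset.attach_map_val (s := k.primeFactors))
  rw [← key m f hf, ← key n g hg]
  exact exists_equiv_iff_map_univ_eq (f := fun p : (m.primeFactors : Set ℕ) => f p)
    (g := fun p : (n.primeFactors : Set ℕ) => g p)

theorem card_divisors_eq_prod_exponentMultiset {n : ℕ} (hn : n ≠ 0) :
    n.divisors.card = ((exponentMultiset n).map (· + 1)).prod := by
  rw [Nat.card_divisors hn, exponentMultiset, Multiset.map_map]
  rfl

theorem pos_of_mem_exponentMultiset {n a : ℕ} (h : a ∈ exponentMultiset n) : 0 < a := by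
  obtain ⟨p, hp, rfl⟩ := Multiset.mem_map.1 h
  exact (Nat.prime_of_mem_primeFactors hp).factorization_pos_of_dvd
    (Nat.mem_primeFactors.1 hp).2.2 (Nat.dvd_of_mem_primeFactors hp)

theorem factorization_prod_prime_pow {ι : Type*} [Fintype ι] {p a : ι → ℕ}
    (hp : ∀ i, (p i).Prime) (hinj : Function.Injective p) (i : ι) :
    (∏ j, p j ^ a j).factorization (p i) = a i := by
  classical
  rw [Nat.factorization_prod_apply fun j _ => pow_ne_zero _ (hp j).ne_zero,
    Finset.sum_eq_single i]
  · simp [(hp i).factorization_self]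
  · intro j _ hj
    rw [(hp j).factorization_pow, Finsupp.single_apply, if_neg fun h => hj (hinj h)]
  · intro h
    exact absurd (Finset.mem_univ i) h

theorem exponentMultiset_prod_prime_pow {ι : Type*} [Fintype ι] {p a : ι → ℕ}
    (hp : ∀ i, (p i).Prime) (hinj : Function.Injective p) (ha : ∀ i, 0 < a i) :
    exponentMultiset (∏ i, p i ^ a i) = Finset.univ.val.map a := by
  classical
  have h0 : ∏ i, p i ^ a i ≠ 0 := Finset.prod_ne_zero_iff.2 fun i _ => pow_ne_zero _ (hp i).ne_zero
  have h : (∏ i, p i ^ a i).primeFactors = Finset.univ.map ⟨p, hinj⟩ := by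
    ext q
    simp only [Nat.mem_primeFactors, Finset.mem_map, Finset.mem_univ, true_and,
      Function.Embedding.coeFn_mk]
    constructor
    · rintro ⟨hq, hd, -⟩
      obtain ⟨i, -, hi⟩ := (Prime.dvd_finsetProd_iff hq.prime _).1 hd
      exact ⟨i, ((Nat.prime_dvd_prime_iff_eq hq (hp i)).1 (hq.dvd_of_dvd_pow hi)).symm⟩
    · rintro ⟨i, rfl⟩
      exact ⟨hp i, (dvd_pow_self _ (ha i).ne').trans (Finset.dvd_prod_of_mem _ (Finset.mem_univ i)),
        h0⟩
  rw [exponentMultiset, h, Finset.map_val, Multiset.map_map]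
  exact Multiset.map_congr rfl fun i _ => factorization_prod_prime_pow hp hinj i

end Multisets

/-! ### The invariants of a similarity class. -/

section Decomposition

/-- For every prime `p` dividing `|M|`, the group `M` maps onto `ℤ_p × ℤ_p`. For a finite abelian
group this says that no nontrivial Sylow subgroup is cyclic. -/
def NoCyclicSylow (M : Type*) [Group M] : Prop :=
  ∀ p, p.Prime → p ∣ Nat.card M →
    ∃ f : M →* Multiplicative (ZMod p × ZMod p), Function.Surjective f

/-- A Sylow subgroup maps onto a Sylow subgroup of the image, here all of `ℤ_p × ℤ_p`, which is not
cyclic. -/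
theorem not_isCyclic_of_surjective {G : Type*} [CommGroup G] [Finite G] {p : ℕ} [Fact p.Prime]
    (f : G →* Multiplicative (ZMod p × ZMod p)) (hf : Function.Surjective f) (P : Sylow p G) :
    ¬ IsCyclic (P : Subgroup G) := by
  intro hP
  have hZ : Nat.card (Multiplicative (ZMod p × ZMod p)) = p ^ 2 := by
    rw [Nat.card_congr Multiplicative.toAdd, Nat.card_prod, Nat.card_zmod, sq]
  have htop : (P : Subgroup G).map f = ⊤ := by
    have h1 := Sylow.card_eq_multiplicity (P.mapSurjective hf)
    rw [hZ, (Fact.out : p.Prime).factorization_pow, Finsupp.single_eq_same, ← hZ,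
      Sylow.coe_mapSurjective] at h1
    exact Subgroup.eq_top_of_card_eq _ h1
  have hcyc : IsCyclic (Multiplicative (ZMod p × ZMod p)) := by
    refine isCyclic_of_surjective (f.comp (P : Subgroup G).subtype) ?_
    intro y
    obtain ⟨x, hx, rfl⟩ : y ∈ (P : Subgroup G).map f := htop ▸ Subgroup.mem_top y
    exact ⟨⟨x, hx⟩, rfl⟩
  have := coprime_card_of_isAddCyclic_prod (M := ZMod p) (N := ZMod p)
    (cyc := isCyclic_multiplicative_iff.1 hcyc)
  rw [Nat.card_zmod, Nat.coprime_self] at this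
  exact (Fact.out : p.Prime).one_lt.ne' this

variable {G : Type u} {M C : Type*} [CommGroup G] [CommGroup M] [CommGroup C]

theorem card_eq_of_mulEquiv_prod (e : G ≃* M × C) : Nat.card G = Nat.card M * Nat.card C := by
  rw [Nat.card_congr e.toEquiv, Nat.card_prod]

theorem sylow_le_ker_fst (e : G ≃* M × C) {p : ℕ} (hp : p.Prime) (h : ¬ p ∣ Nat.card M)
    (P : Sylow p G) : (P : Subgroup G) ≤ ((MonoidHom.fst M C).comp e.toMonoidHom).ker := by
  intro x hx
  obtain ⟨k, hk⟩ := P.2 ⟨x, hx⟩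
  have hk' : x ^ p ^ k = 1 := congrArg Subtype.val hk
  have h1 : orderOf (e x).1 ∣ p ^ k := by
    rw [orderOf_dvd_iff_pow_eq_one, ← Prod.pow_fst, ← map_pow, hk', map_one]
    rfl
  have h2 : orderOf (e x).1 ∣ Nat.card M := orderOf_dvd_natCard _
  have h3 : (p ^ k).Coprime (Nat.card M) := ((Nat.Prime.coprime_iff_not_dvd hp).2 h).pow_left k
  exact orderOf_eq_one_iff.1 (Nat.eq_one_of_dvd_coprimes h3 h1 h2)

theorem card_ker_fst (e : G ≃* M × C) :
    Nat.card ((MonoidHom.fst M C).comp e.toMonoidHom).ker = Nat.card C := by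
  refine Nat.card_congr (Equiv.ofBijective (fun x => (e x.1).2) ⟨?_, ?_⟩)
  · rintro ⟨x, hx⟩ ⟨y, hy⟩ h
    exact Subtype.ext (e.injective (Prod.ext (hx.trans hy.symm) h))
  · intro c
    exact ⟨⟨e.symm (1, c), by simp [Subgroup.mem_prod]⟩, by simp⟩

theorem isCompl_ker_fst_ker_snd (e : G ≃* M × C) :
    IsCompl ((MonoidHom.fst M C).comp e.toMonoidHom).ker
      ((MonoidHom.snd M C).comp e.toMonoidHom).ker := by
  refine IsCompl.of_eq ?_ ?_
  · rw [eq_bot_iff]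
    rintro x ⟨h1, h2⟩
    exact e.map_eq_one_iff.1 (Prod.ext h1 h2)
  · rw [eq_top_iff]
    intro x _
    rw [show x = e.symm (1, (e x).2) * e.symm ((e x).1, 1) by
      rw [← map_mul]; simp]
    refine Subgroup.mul_mem_sup ?_ ?_ <;> simp [Subgroup.mem_prod]

/-- Makes the choice of the complements in `IsSimilar` irrelevant: all complements of one kernel are
isomorphic to the image. -/
theorem nonempty_mulEquiv_of_isCompl_ker {f : G →* M} (hf : Function.Surjective f)
    {K : Subgroup G} (h : IsCompl f.ker K) : Nonempty (K ≃* M) := by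
  refine ⟨MulEquiv.ofBijective (f.comp K.subtype) ⟨?_, ?_⟩⟩
  · rw [injective_iff_map_eq_one]
    rintro ⟨x, hx⟩ hx'
    have : x ∈ f.ker ⊓ K := ⟨hx', hx⟩
    rw [h.inf_eq_bot] at this
    exact Subtype.ext this
  · intro m
    obtain ⟨x, rfl⟩ := hf m
    have hx : x ∈ f.ker ⊔ K := h.sup_eq_top ▸ Subgroup.mem_top x
    obtain ⟨y, hy, z, hz, rfl⟩ := Subgroup.mem_sup.1 hx
    refine ⟨⟨z, hz⟩, ?_⟩
    rw [map_mul, MonoidHom.mem_ker.1 hy, one_mul]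
    rfl

variable [Finite M] [Finite C]

theorem not_dvd_of_coprime_of_dvd {p m n : ℕ} (hp : p.Prime) (h : m.Coprime n) (hn : p ∣ n) :
    ¬ p ∣ m := fun hm => hp.one_lt.ne' (Nat.eq_one_of_dvd_coprimes h hm hn)

theorem factorization_card_of_coprime (e : G ≃* M × C) (hc : (Nat.card M).Coprime (Nat.card C))
    {p : ℕ} (hp : p.Prime) (h : p ∣ Nat.card C) :
    (Nat.card G).factorization p = (Nat.card C).factorization p := by
  rw [card_eq_of_mulEquiv_prod e, Nat.factorization_mul Nat.card_pos.ne' Nat.card_pos.ne',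
    Finsupp.add_apply,
    Nat.factorization_eq_zero_of_not_dvd (not_dvd_of_coprime_of_dvd hp hc h), zero_add]

theorem cyclicCentralPrimes_eq [IsCyclic C] (e : G ≃* M × C)
    (hc : (Nat.card M).Coprime (Nat.card C)) (hM : NoCyclicSylow M) :
    cyclicCentralPrimes G = (Nat.card C).primeFactors := by
  have : Finite G := Finite.of_equiv _ e.symm.toEquiv
  ext p
  simp only [cyclicCentralPrimes, Set.mem_ofPred_eq, Finset.mem_coe, Nat.mem_primeFactors]
  constructor
  · rintro ⟨hp, hd, P, hP, -⟩
    refine ⟨hp, ?_, Nat.card_pos.ne'⟩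
    rw [card_eq_of_mulEquiv_prod e] at hd
    refine (hp.dvd_mul.1 hd).resolve_left fun hd => ?_
    obtain ⟨f, hf⟩ := hM p hp hd
    have : Fact p.Prime := ⟨hp⟩
    exact not_isCyclic_of_surjective (f.comp ((MonoidHom.fst M C).comp e.toMonoidHom))
      (hf.comp (Prod.fst_surjective.comp e.surjective)) P hP
  · rintro ⟨hp, hd, -⟩
    refine ⟨hp, ?_, (default : Sylow p G), ?_, ?_⟩
    · rw [card_eq_of_mulEquiv_prod e]
      exact hd.mul_left _
    · refine isCyclic_of_injective ((MonoidHom.snd M C).comp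
        (e.toMonoidHom.comp ((default : Sylow p G) : Subgroup G).subtype)) ?_
      rw [injective_iff_map_eq_one]
      rintro ⟨x, hx⟩ h
      have h1 := sylow_le_ker_fst e hp (not_dvd_of_coprime_of_dvd hp hc hd) default hx
      exact Subtype.ext (e.map_eq_one_iff.1 (Prod.ext h1 h))
    · rw [CommGroup.center_eq_top]
      exact le_top

/-- Sylow subgroups for primes dividing `|C|` have trivial image in `M`, which gives one inclusion.
Equality follows from orders: the left side contains a full Sylow `p`-subgroup for each such `p`, so
every prime power dividing `|C|` divides its order. -/
theorem cyclicCentralPart_eq [IsCyclic C] (e : G ≃* M × C)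
    (hc : (Nat.card M).Coprime (Nat.card C)) (hM : NoCyclicSylow M) :
    cyclicCentralPart G = ((MonoidHom.fst M C).comp e.toMonoidHom).ker := by
  have : Finite G := Finite.of_equiv _ e.symm.toEquiv
  have hS := cyclicCentralPrimes_eq e hc hM
  refine Subgroup.eq_of_le_of_card_ge ?_ (Nat.le_of_dvd Nat.card_pos ?_)
  · refine iSup₂_le fun p hp => iSup_le fun P => ?_
    rw [hS, Finset.mem_coe, Nat.mem_primeFactors] at hp
    exact sylow_le_ker_fst e hp.1 (not_dvd_of_coprime_of_dvd hp.1 hc hp.2.1) P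
  · rw [card_ker_fst, Nat.dvd_iff_prime_pow_dvd_dvd]
    intro p k hp hd
    rcases Nat.eq_zero_or_pos k with rfl | hk
    · simp
    have hpC : p ∣ Nat.card C := (dvd_pow_self p hk.ne').trans hd
    have : Fact p.Prime := ⟨hp⟩
    have hle : ((default : Sylow p G) : Subgroup G) ≤ cyclicCentralPart G := by
      have hpS : p ∈ cyclicCentralPrimes G := by
        rw [hS, Finset.mem_coe, Nat.mem_primeFactors]
        exact ⟨hp, hpC, Nat.card_pos.ne'⟩
      exact (le_iSup (fun P : Sylow p G => (P : Subgroup G)) default).trans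
        (le_iSup₂ (f := fun p (_ : p ∈ cyclicCentralPrimes G) =>
          ⨆ P : Sylow p G, (P : Subgroup G)) p hpS)
    refine dvd_trans ?_ (Subgroup.card_dvd_of_le hle)
    rw [Sylow.card_eq_multiplicity, factorization_card_of_coprime e hc hp hpC]
    exact pow_dvd_pow p ((hp.pow_dvd_iff_le_factorization Nat.card_pos.ne').1 hd)

/-- Similarity in terms of decompositions `G ≅ M × C`, `H ≅ N × D` into a part without cyclic
Sylow subgroups and a cyclic part of coprime order. -/
theorem isSimilar_iff {H : Type v} {N D : Type*} [CommGroup H] [CommGroup N] [CommGroup D]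
    [Finite N] [Finite D] [IsCyclic C] [IsCyclic D] (e : G ≃* M × C) (e' : H ≃* N × D)
    (hc : (Nat.card M).Coprime (Nat.card C)) (hc' : (Nat.card N).Coprime (Nat.card D))
    (hM : NoCyclicSylow M) (hN : NoCyclicSylow N) :
    IsSimilar G H ↔ Nonempty (M ≃* N) ∧
      exponentMultiset (Nat.card C) = exponentMultiset (Nat.card D) := by
  have hS := cyclicCentralPrimes_eq e hc hM
  have hT := cyclicCentralPrimes_eq e' hc' hN
  have hf : Function.Surjective ((MonoidHom.fst M C).comp e.toMonoidHom) :=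
    Prod.fst_surjective.comp e.surjective
  have hf' : Function.Surjective ((MonoidHom.fst N D).comp e'.toMonoidHom) :=
    Prod.fst_surjective.comp e'.surjective
  refine and_congr ?_ (exists_equiv_iff_exponentMultiset_eq hS hT ?_ ?_)
  · rw [cyclicCentralPart_eq e hc hM, cyclicCentralPart_eq e' hc' hN]
    constructor
    · rintro ⟨K, L, hK, hL, ⟨g⟩⟩
      obtain ⟨a⟩ := nonempty_mulEquiv_of_isCompl_ker hf hK
      obtain ⟨b⟩ := nonempty_mulEquiv_of_isCompl_ker hf' hL
      exact ⟨a.symm.trans (g.trans b)⟩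
    · rintro ⟨g⟩
      have hK := isCompl_ker_fst_ker_snd e
      have hL := isCompl_ker_fst_ker_snd e'
      obtain ⟨a⟩ := nonempty_mulEquiv_of_isCompl_ker hf hK
      obtain ⟨b⟩ := nonempty_mulEquiv_of_isCompl_ker hf' hL
      exact ⟨_, _, hK, hL, ⟨a.trans (g.trans b.symm)⟩⟩
  · intro p hp
    rw [hS, Finset.mem_coe, Nat.mem_primeFactors] at hp
    exact factorization_card_of_coprime e hc hp.1 hp.2.1
  · intro p hp
    rw [hT, Finset.mem_coe, Nat.mem_primeFactors] at hp
    exact factorization_card_of_coprime e' hc' hp.1 hp.2.1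

end Decomposition

/-! ### Groups without cyclic Sylow subgroups and with at most `22` subgroups; decomposition of
finite abelian groups. -/

section Classification

/-- The types `(p, a, b)` of the groups `ℤ_{p ^ a} × ℤ_{p ^ b}` with `1 ≤ b ≤ a` and at most
`22` subgroups. -/
def smallRankTwo : List (ℕ × ℕ × ℕ) :=
  [(2, 1, 1), (3, 1, 1), (5, 1, 1), (7, 1, 1), (11, 1, 1), (13, 1, 1), (17, 1, 1), (19, 1, 1),
    (2, 2, 1), (3, 2, 1), (5, 2, 1), (7, 2, 1), (2, 3, 1), (3, 3, 1), (5, 3, 1), (2, 4, 1),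
    (3, 4, 1), (2, 5, 1), (3, 5, 1), (2, 6, 1), (2, 2, 2), (2, 3, 2)]

/-- The lists `[p ^ a₁, …, p ^ aᵣ]` of orders of the cyclic factors of the abelian `p`-groups
without cyclic Sylow subgroups and with at most `22` subgroups, given as triples
`(p, [a₁, …, aᵣ], number of subgroups)`. -/
def smallTypes : List (ℕ × List ℕ × ℕ) :=
  (2, [], 1) :: (2, [1, 1, 1], 16) ::
    smallRankTwo.map fun x => (x.1, [x.2.1, x.2.2], rankTwoCount x.1 x.2.1 x.2.2)

/-- The orders of the cyclic factors in a triple from `smallTypes`. -/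
abbrev typeModuli (x : ℕ × List ℕ × ℕ) : List ℕ := x.2.1.map (x.1 ^ ·)

/-- The product of the groups `ℤ_m`, `m ∈ l`. -/
abbrev PiZMod (l : List ℕ) : Type := ∀ j : Fin l.length, ZMod (l.get j)

theorem prime_of_mem_smallRankTwo : ∀ x ∈ smallRankTwo, x.1.Prime ∧ 0 < x.2.2 ∧ x.2.2 ≤ x.2.1 := by
  decide +kernel

theorem mem_smallRankTwo_of_lt : ∀ p ∈ Finset.range 20, ∀ a ∈ Finset.range 10,
    ∀ b ∈ Finset.range 10, p.Prime ∧ 0 < b ∧ b ≤ a ∧ rankTwoCount p a b ≤ 22 →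
      (p, a, b) ∈ smallRankTwo := by
  decide +kernel

theorem mem_smallRankTwo {p a b : ℕ} (hp : p.Prime) (hb : 0 < b) (hba : b ≤ a)
    (h : rankTwoCount p a b ≤ 22) : (p, a, b) ∈ smallRankTwo := by
  -- `ℤ_p × ℤ_p` has `p + 3` subgroups.
  have hp20 : p < 20 := by
    have := rankTwoCount_mono (le_refl p) (hb.trans_le hba) hb
    simp only [rankTwoCount, Nat.succ_eq_add_one, Finset.sum_range_succ] at this h
    simp at this
    omega
  have ha : a < 10 := by
    by_contra ha
    have h1 := rankTwoCount_mono hp.two_le (not_lt.1 ha) hb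
    -- The count for `ℤ_{2^a} × ℤ_2` is `3a + 2`.
    have h2 : 22 < rankTwoCount 2 10 (Nat.succ 0) := by decide +kernel
    omega
  exact mem_smallRankTwo_of_lt p (Finset.mem_range.2 hp20) a (Finset.mem_range.2 ha) b
    (Finset.mem_range.2 (hba.trans_lt ha)) ⟨hp, hb, hba, h⟩

theorem mem_smallTypes_iff {x : ℕ × List ℕ × ℕ} : x ∈ smallTypes ↔ x = (2, [], 1) ∨
    x = (2, [1, 1, 1], 16) ∨ ∃ p a b, (p, a, b) ∈ smallRankTwo ∧
      x = (p, [a, b], rankTwoCount p a b) := by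
  simp [smallTypes, eq_comm]

theorem card_addSubgroup_of_mem_smallTypes {x : ℕ × List ℕ × ℕ} (hx : x ∈ smallTypes) :
    Nat.card (AddSubgroup (PiZMod (typeModuli x))) = x.2.2 := by
  rcases mem_smallTypes_iff.1 hx with rfl | rfl | ⟨p, a, b, h, rfl⟩
  · have : IsEmpty (Fin (typeModuli (2, [], 1)).length) := Fin.isEmpty
    exact Nat.card_unique
  · exact card_addSubgroup_fin_three Nat.prime_two 1 rfl rfl rfl
  · exact card_addSubgroup_fin_two (prime_of_mem_smallRankTwo _ h).1 a b rfl rfl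

/-- Two coordinates whose moduli are divisible by `q`, reduced modulo `q`, give the map onto `ℤ_q ×
ℤ_q`. -/
theorem noCyclicSylow_pi {ι : Type*} [Fintype ι] {n : ι → ℕ}
    (h : ∀ i q, q.Prime → q ∣ n i → ∃ j, j ≠ i ∧ q ∣ n j) :
    NoCyclicSylow (Multiplicative (∀ i, ZMod (n i))) := by
  intro q hq hd
  rw [Nat.card_congr Multiplicative.toAdd, Nat.card_pi] at hd
  obtain ⟨i, -, hi⟩ := (Prime.dvd_finsetProd_iff hq.prime _).1 hd
  rw [Nat.card_zmod] at hi
  obtain ⟨j, hji, hj⟩ := h i q hq hi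
  obtain ⟨φ, hφ⟩ := exists_surjective_zmod_pi (n := n) (d := fun _ : Fin 2 => q) ![i, j]
    (by
      intro a b
      fin_cases a <;> fin_cases b <;> simp [hji, hji.symm])
    (by
      intro k
      fin_cases k <;> simp [hi, hj])
  let E := (LinearEquiv.piFinTwo ℤ fun _ : Fin 2 => ZMod q).toAddEquiv
  exact ⟨(E.toAddMonoidHom.comp φ).toMultiplicative, E.surjective.comp hφ⟩

theorem noCyclicSylow_of_mem_smallTypes {x : ℕ × List ℕ × ℕ} (hx : x ∈ smallTypes) :
    NoCyclicSylow (Multiplicative (PiZMod (typeModuli x))) := by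
  have key : ∀ x ∈ smallTypes, x.1.Prime ∧ x.2.1.length ≠ 1 ∧ ∀ a ∈ x.2.1, 0 < a := by
    decide +kernel
  obtain ⟨hp, hl, ha⟩ := key x hx
  refine noCyclicSylow_pi fun i q hq hd => ?_
  have hget : ∀ i, ∃ a, 0 < a ∧ (typeModuli x).get i = x.1 ^ a := by
    intro i
    obtain ⟨a, h, h'⟩ := List.mem_map.1 (List.get_mem (typeModuli x) i)
    exact ⟨a, ha a h, h'.symm⟩
  have hlen : (typeModuli x).length ≠ 1 := by simpa using hl
  have hi := i.2
  obtain ⟨j, hj⟩ : ∃ j : Fin (typeModuli x).length, j ≠ i := by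
    have : Nontrivial (Fin (typeModuli x).length) := Fin.nontrivial_iff_two_le.2 (by omega)
    exact exists_ne i
  obtain ⟨a, -, e⟩ := hget i
  obtain ⟨b, hb, e'⟩ := hget j
  rw [e] at hd
  obtain rfl := (Nat.prime_dvd_prime_iff_eq hq hp).1 (hq.dvd_of_dvd_pow hd)
  exact ⟨j, hj, e' ▸ dvd_pow_self _ hb.ne'⟩

theorem card_addSubgroup_le_of_injective {ι κ : Type*} [Finite ι] {n : ι → ℕ} {d : κ → ℕ}
    (hn : ∀ i, n i ≠ 0) (f : κ → ι) (hf : Function.Injective f) (h : ∀ k, d k ∣ n (f k)) :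
    Nat.card (AddSubgroup (∀ k, ZMod (d k))) ≤ Nat.card (AddSubgroup (∀ i, ZMod (n i))) := by
  have : ∀ i, NeZero (n i) := fun i => ⟨hn i⟩
  obtain ⟨φ, hφ⟩ := exists_surjective_zmod_pi f hf h
  exact card_addSubgroup_le_of_surjective φ hφ

theorem lt_card_addSubgroup_of_two_primes {d d' : Fin 2 → ℕ} {p q : ℕ} (hp : p.Prime)
    (hq : q.Prime) (hpq : p ≠ q) (hd : ∀ k, d k = p) (hd' : ∀ k, d' k = q) :
    22 < Nat.card (AddSubgroup (∀ k, ZMod (Sum.elim d d' k))) := by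
  have : ∀ k, NeZero (d k) := fun k => ⟨by rw [hd]; exact hp.ne_zero⟩
  have : ∀ k, NeZero (d' k) := fun k => ⟨by rw [hd']; exact hq.ne_zero⟩
  let E := (LinearEquiv.sumPiEquivProdPi ℤ (Fin 2) (Fin 2)
    fun k => ZMod (Sum.elim d d' k)).toAddEquiv
  rw [card_addSubgroup_congr E]
  refine lt_of_lt_of_le ?_ (mul_card_le_card_addSubgroup_prod (A := ∀ k, ZMod (d k))
    (B := ∀ k, ZMod (d' k)))
  rw [card_addSubgroup_fin_two hp 1 1 (by simp [hd]) (by simp [hd]),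
    card_addSubgroup_fin_two hq 1 1 (by simp [hd']) (by simp [hd'])]
  have h2 := hp.two_le
  have h2' := hq.two_le
  have r22 : rankTwoCount 2 1 1 = 5 := by decide
  have r33 : rankTwoCount 3 1 1 = 6 := by decide
  -- The larger prime is at least `3`, so the product is at least `5 · 6 = 30`.
  rcases Nat.lt_or_gt_of_ne hpq with h | h
  · have := Nat.mul_le_mul (rankTwoCount_mono h2 (le_refl 1) (le_refl 1))
      (rankTwoCount_mono (show 3 ≤ q by omega) (le_refl 1) (le_refl 1))
    rw [r22, r33] at this
    omega
  · have := Nat.mul_le_mul (rankTwoCount_mono (show 3 ≤ p by omega) (le_refl 1) (le_refl 1))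
      (rankTwoCount_mono h2' (le_refl 1) (le_refl 1))
    rw [r22, r33] at this
    omega

/-- An abelian group without cyclic Sylow subgroups and with at most `22` subgroups is one of
the groups in `smallTypes`. -/
theorem exists_mem_smallTypes {ι : Type*} [Fintype ι] {p e : ι → ℕ} (hp : ∀ i, (p i).Prime)
    (he : ∀ i, 0 < e i) (hpair : ∀ i, ∃ j, j ≠ i ∧ p j = p i)
    (hcard : Nat.card (AddSubgroup (∀ i, ZMod (p i ^ e i))) ≤ 22) :
    ∃ x ∈ smallTypes, Nonempty ((∀ i, ZMod (p i ^ e i)) ≃+ PiZMod (typeModuli x)) := by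
  classical
  have hn : ∀ i, p i ^ e i ≠ 0 := fun i => pow_ne_zero _ (hp i).ne_zero
  have hdvd : ∀ i, p i ∣ p i ^ e i := fun i => dvd_pow_self _ (he i).ne'
  rcases isEmpty_or_nonempty ι with hι | ⟨⟨i₀⟩⟩
  · exact ⟨(2, [], 1), mem_smallTypes_iff.2 (Or.inl rfl),
      nonempty_addEquiv_zmod_pi (κ := Fin 0) (Equiv.equivOfIsEmpty _ _) fun k => k.elim0⟩
  -- A second prime would give a quotient `ℤ_p ^ 2 × ℤ_q ^ 2`, which has too many subgroups.
  have hall : ∀ i, p i = p i₀ := by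
    intro i
    by_contra hi
    obtain ⟨j₀, hj₀, ej₀⟩ := hpair i₀
    obtain ⟨j, hj, ej⟩ := hpair i
    have hlt := lt_card_addSubgroup_of_two_primes (d := fun _ => p i₀) (d' := fun _ => p i)
      (hp i₀) (hp i) (Ne.symm hi) (fun _ => rfl) (fun _ => rfl)
    refine (hlt.trans_le ((card_addSubgroup_le_of_injective hn (Sum.elim ![i₀, j₀] ![i, j])
      ?_ ?_).trans hcard)).ne rfl
    · refine Function.Injective.sumElim ?_ ?_ ?_
      · intro a b
        fin_cases a <;> fin_cases b <;> simp [hj₀, hj₀.symm]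
      · intro a b
        fin_cases a <;> fin_cases b <;> simp [hj, hj.symm]
      · have hne : ∀ a b, p a = p i₀ → p b = p i → a ≠ b := by
          rintro a _ h h' rfl
          exact hi (h'.symm.trans h)
        intro a b
        fin_cases a <;> fin_cases b <;> exact hne _ _ (by first | rfl | exact ej₀)
          (by first | rfl | exact ej)
    · rintro (k | k)
      · fin_cases k
        · exact hdvd i₀
        · exact ej₀ ▸ hdvd j₀
      · fin_cases k
        · exact hdvd i
        · exact ej ▸ hdvd j
  generalize hq : p i₀ = q at hall
  obtain rfl : p = fun _ => q := funext hall
  replace hp : q.Prime := hp i₀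
  have hone : Fintype.card ι ≠ 1 := by
    intro h
    obtain ⟨j, hj, -⟩ := hpair i₀
    exact hj (Fintype.card_le_one_iff.1 h.le j i₀)
  have hpos : 0 < Fintype.card ι := Fintype.card_pos_iff.2 ⟨i₀⟩
  rcases (show Fintype.card ι = 2 ∨ 3 ≤ Fintype.card ι by omega) with h2 | h3
  · obtain ⟨σ, hσ⟩ : ∃ σ : Fin 2 ≃ ι, e (σ 1) ≤ e (σ 0) := by
      let τ : Fin 2 ≃ ι := (Fintype.equivFinOfCardEq h2).symm
      rcases le_total (e (τ 1)) (e (τ 0)) with h | h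
      · exact ⟨τ, h⟩
      · exact ⟨(Equiv.swap 0 1).trans τ, by simpa using h⟩
    obtain ⟨E⟩ := nonempty_addEquiv_zmod_pi (n := fun i => q ^ e i)
      -- `typeModuli` ignores the last component, so `0` is a dummy.
      (d := (typeModuli (q, [e (σ 0), e (σ 1)], 0)).get) σ (by
        intro k
        change Fin 2 at k
        fin_cases k <;> rfl)
    have hc := card_addSubgroup_fin_two hp (e (σ 0)) (e (σ 1))
      (d := (typeModuli (q, [e (σ 0), e (σ 1)], 0)).get) rfl rfl
    rw [card_addSubgroup_congr E] at hcard
    exact ⟨(q, [e (σ 0), e (σ 1)], rankTwoCount q (e (σ 0)) (e (σ 1))),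
      mem_smallTypes_iff.2 (Or.inr (Or.inr ⟨_, _, _,
        mem_smallRankTwo hp (he _) hσ (hc.ge.trans hcard), rfl⟩)), ⟨E⟩⟩
  -- Any given index can come first; this is used to put an exponent at least `2` in front.
  · have hemb : ∀ i, ∃ f : Fin 3 ↪ ι, f 0 = i := by
      intro i
      obtain ⟨f⟩ : Nonempty (Fin 3 ↪ ι) :=
        Function.Embedding.nonempty_of_card_le (by simpa using h3)
      exact ⟨f.trans (Equiv.swap (f 0) i).toEmbedding, by simp⟩
    have hq2 : q = 2 := by
      by_contra hne
      have h3q : 3 ≤ q := by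
        have := hp.two_le
        omega
      obtain ⟨f, -⟩ := hemb i₀
      have := (card_addSubgroup_le_of_injective (d := fun _ => q) hn f f.injective
        fun k => hdvd (f k)).trans hcard
      rw [card_addSubgroup_fin_three hp 1 (pow_one q).symm rfl rfl] at this
      -- For `q = 3` the count is already `28`.
      nlinarith
    subst hq2
    have he1 : ∀ i, e i = 1 := by
      intro i
      by_contra hne
      have h2i : 2 ≤ e i := by
        have := he i
        omega
      obtain ⟨f, hf⟩ := hemb i
      have := (card_addSubgroup_le_of_injective (d := ![4, 2, 2]) hn f f.injective (by
        intro k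
        fin_cases k
        · exact hf.symm ▸ pow_dvd_pow 2 h2i
        · exact hdvd (f 1)
        · exact hdvd (f 2))).trans hcard
      -- `ℤ_4 × ℤ_2 × ℤ_2` has `27` subgroups.
      rw [card_addSubgroup_fin_three Nat.prime_two 2 rfl rfl rfl] at this
      omega
    obtain rfl : e = fun _ => 1 := funext he1
    have hcard3 : Fintype.card ι = 3 := by
      by_contra hne
      obtain ⟨f⟩ : Nonempty (Fin 4 ↪ ι) :=
        Function.Embedding.nonempty_of_card_le (by rw [Fintype.card_fin]; omega)
      have h4 := card_addSubgroup_fin_four (d := fun _ => 2) fun _ => rfl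
      have := (card_addSubgroup_le_of_injective (d := fun _ => 2) hn f f.injective
        fun k => hdvd (f k)).trans hcard
      omega
    exact ⟨(2, [1, 1, 1], 16), mem_smallTypes_iff.2 (Or.inr (Or.inl rfl)),
      nonempty_addEquiv_zmod_pi (κ := Fin 3) (Fintype.equivFinOfCardEq hcard3).symm (by
        intro k
        fin_cases k <;> rfl)⟩

/-- A finite abelian group is the product of a group without cyclic Sylow subgroups and a cyclic
group of coprime order. -/
theorem exists_decomposition (G : Type*) [CommGroup G] [Finite G] :
    ∃ (ι : Type) (_ : Fintype ι) (p e : ι → ℕ) (N : ℕ), (∀ i, (p i).Prime) ∧ (∀ i, 0 < e i) ∧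
      (∀ i, ∃ j, j ≠ i ∧ p j = p i) ∧ N ≠ 0 ∧
      (Nat.card (∀ i, ZMod (p i ^ e i))).Coprime N ∧
      Nonempty (G ≃* Multiplicative (∀ i, ZMod (p i ^ e i)) × Multiplicative (ZMod N)) := by
  classical
  obtain ⟨ι, _, p, hp, e, ⟨E₀⟩⟩ := AddCommGroup.equiv_directSum_zmod_of_finite (Additive G)
  let E := E₀.trans (DirectSum.addEquivProd _)
  -- The indices whose prime occurs in another nontrivial factor. Zero exponents may occur in the
  -- structure theorem, and those trivial factors go to the cyclic part.
  let U : ι → Prop := fun i => e i ≠ 0 ∧ ∃ j, j ≠ i ∧ e j ≠ 0 ∧ p j = p i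
  have hU : ∀ i j, i ≠ j → ¬ U j → (p i ^ e i).Coprime (p j ^ e j) := by
    intro i j hij hj
    by_cases hi : e i = 0
    · simp [hi]
    by_cases hj' : e j = 0
    · simp [hj']
    · exact Nat.Coprime.pow _ _ ((Nat.coprime_primes (hp i) (hp j)).2 fun h =>
        hj ⟨hj', i, hij, hi, h⟩)
  let E₁ : (∀ i, ZMod (p i ^ e i)) ≃+
      (∀ i : {i // U i}, ZMod (p i ^ e i)) × ∀ i : {i // ¬ U i}, ZMod (p i ^ e i) :=
    { Equiv.piEquivPiSubtypeProd U fun i => ZMod (p i ^ e i) with map_add' := fun _ _ => rfl }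
  have hco : Pairwise (Function.onFun Nat.Coprime fun i : {i // ¬ U i} => p i ^ e i) :=
    fun i j hij => hU i j (fun h => hij (Subtype.ext h)) j.2
  let E₂ := (ZMod.prodEquivPi (fun i : {i // ¬ U i} => p i ^ e i) hco).toAddEquiv
  refine ⟨{i // U i}, inferInstance, fun i => p i, fun i => e i, ∏ i : {i // ¬ U i}, p i ^ e i,
    fun i => hp i, fun i => Nat.pos_of_ne_zero i.2.1, ?_, ?_, ?_, ?_⟩
  · rintro ⟨i, hi, j, hj, hj', h⟩
    exact ⟨⟨j, hj', i, hj.symm, hi, h.symm⟩, fun h' => hj (congrArg Subtype.val h'), h⟩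
  · exact Finset.prod_ne_zero_iff.2 fun i _ => pow_ne_zero _ (hp i).ne_zero
  · rw [Nat.card_pi]
    refine Nat.Coprime.prod_left fun i _ => Nat.Coprime.prod_right fun j _ => ?_
    rw [Nat.card_zmod]
    exact hU i j (fun h => j.2 (h ▸ i.2)) j.2
  · let E₃ := (E.trans E₁).trans ((AddEquiv.refl _).prodCongr E₂.symm)
    exact ⟨(AddEquiv.toMultiplicativeRight E₃).trans (MulEquiv.prodMultiplicative _ _)⟩

theorem noCyclicSylow_of_paired {ι : Type*} [Fintype ι] {p e : ι → ℕ} (hp : ∀ i, (p i).Prime)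
    (he : ∀ i, 0 < e i) (hpair : ∀ i, ∃ j, j ≠ i ∧ p j = p i) :
    NoCyclicSylow (Multiplicative (∀ i, ZMod (p i ^ e i))) := by
  refine noCyclicSylow_pi fun i q hq hd => ?_
  obtain rfl := (Nat.prime_dvd_prime_iff_eq hq (hp i)).1 (hq.dvd_of_dvd_pow hd)
  obtain ⟨j, hj, h⟩ := hpair i
  exact ⟨j, hj, h ▸ dvd_pow_self _ (he j).ne'⟩

theorem card_subgroup_of_decomposition {G A : Type*} [CommGroup G] [AddCommGroup A] [Finite A]
    {N : ℕ} (hN : N ≠ 0) (hc : (Nat.card A).Coprime N)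
    (e : G ≃* Multiplicative A × Multiplicative (ZMod N)) :
    Nat.card (Subgroup G) =
      Nat.card (AddSubgroup A) * ((exponentMultiset N).map (· + 1)).prod := by
  have : NeZero N := ⟨hN⟩
  rw [Nat.card_congr (e.trans (MulEquiv.prodMultiplicative A (ZMod N)).symm).mapSubgroup.toEquiv,
    Nat.card_congr (AddSubgroup.toSubgroup (A := A × ZMod N)).symm.toEquiv,
    card_addSubgroup_prod_of_coprime (by rwa [Nat.card_zmod]), card_addSubgroup_zmod,
    card_divisors_eq_prod_exponentMultiset hN]

/-- A group with finitely many subgroups is finite. -/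
theorem finite_of_finite_subgroup (G : Type*) [Group G] [Finite (Subgroup G)] : Finite G := by
  have hfin : ∀ g : G, (Subgroup.zpowers g : Set G).Finite := by
    intro g
    rw [← Set.finite_coe_iff]
    refine finite_zpowers.2 ?_
    by_contra hg
    -- If `g` had infinite order, two of its positive powers would generate the same subgroup, hence
    -- be equal or inverse to each other; either is absurd.
    obtain ⟨m, n, hmn, h⟩ := Finite.exists_ne_map_eq_of_infinite
      fun n : ℕ => Subgroup.zpowers (g ^ (n + 1))
    have hm : ¬ IsOfFinOrder (g ^ (m + 1)) := fun h => hg (h.of_pow m.succ_ne_zero)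
    rcases (Subgroup.zpowers_eq_zpowers_iff hm).1 h with h | h
    · exact hmn (Nat.succ_injective (injective_pow_iff_not_isOfFinOrder.2 hg h))
    · refine hg (isOfFinOrder_iff_pow_eq_one.2 ⟨m + 1 + (n + 1), by omega, ?_⟩)
      rw [pow_add, ← h, mul_inv_cancel]
  -- Elements are sorted by the cyclic subgroup they generate: there are finitely many classes, each
  -- inside a finite cyclic group.
  have : (Set.univ : Set G) = ⋃ K : Subgroup G, {g | Subgroup.zpowers g = K} := by
    ext g
    simp
  rw [← Set.finite_univ_iff, this]
  refine Set.finite_iUnion fun K => ?_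
  rcases Set.eq_empty_or_nonempty {g | Subgroup.zpowers g = K} with h | ⟨g, hg⟩
  · rw [h]
    exact Set.finite_empty
  · refine (hfin g).subset fun x hx => ?_
    have hx : Subgroup.zpowers x = K := hx
    have hg : Subgroup.zpowers g = K := hg
    rw [hg, ← hx]
    exact Subgroup.mem_zpowers x

end Classification

/-! ### Enumeration of the factorizations of a number. -/

section Factorizations

/-- The weakly decreasing lists `[a₁, …, aₛ]` of positive integers `≤ b` with
`(a₁ + 1) ⋯ (aₛ + 1) = n` and `s ≤ f`. -/
def exponentLists : ℕ → ℕ → ℕ → List (List ℕ)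
  | 0, _, n => if n = 1 then [[]] else []
  | f + 1, b, n => (if n = 1 then [[]] else []) ++
      ((List.range (b + 1)).filter fun a => 0 < a ∧ a + 1 ∣ n).flatMap fun a =>
        (exponentLists f a (n / (a + 1))).map (a :: ·)

theorem mem_exponentLists {l : List ℕ} : ∀ {f b : ℕ}, l.Pairwise (· ≥ ·) →
    (∀ a ∈ l, 0 < a ∧ a ≤ b) → l.length ≤ f →
      l ∈ exponentLists f b (l.map (· + 1)).prod := by
  induction l with
  | nil =>
    intro f b _ _ _
    cases f <;> simp [exponentLists]
  | cons a l ih =>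
    intro f b hl hb hf
    obtain ⟨h1, h2⟩ := List.pairwise_cons.1 hl
    obtain _ | f := f
    · simp at hf
    rw [exponentLists, List.mem_append, List.mem_flatMap]
    refine Or.inr ⟨a, ?_, ?_⟩
    · have := hb a List.mem_cons_self
      simp only [List.map_cons, List.prod_cons, List.mem_filter, List.mem_range, dvd_mul_right,
        and_true, decide_eq_true_eq]
      omega
    · rw [List.map_cons, List.prod_cons, Nat.mul_div_cancel_left _ a.succ_pos]
      refine List.mem_map.2 ⟨l, ih h2 (fun c hc => ⟨(hb c (List.mem_cons_of_mem a hc)).1, h1 c hc⟩) ?_,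
        rfl⟩
      simpa using hf

theorem length_lt_prod_succ {l : List ℕ} (h : ∀ a ∈ l, 0 < a) :
    l.length < (l.map (· + 1)).prod := by
  induction l with
  | nil => simp
  | cons a l ih =>
    have h1 := ih fun b hb => h b (List.mem_cons_of_mem a hb)
    have h2 := h a List.mem_cons_self
    rw [List.map_cons, List.prod_cons, List.length_cons]
    nlinarith

/-- Both bounds may be taken to be `n`: every factor is at least `2`, so there are fewer than `n` of
them, and each `a + 1` divides `n`. -/
theorem mem_exponentLists_self {l : List ℕ} (hl : l.Pairwise (· ≥ ·)) (h : ∀ a ∈ l, 0 < a) {n : ℕ}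
    (hn : (l.map (· + 1)).prod = n) : l ∈ exponentLists n n n := by
  have hn0 : 0 < n := hn ▸ (Nat.zero_le _).trans_lt (length_lt_prod_succ h)
  have := mem_exponentLists (f := n) (b := n) hl (fun a ha => ⟨h a ha, ?_⟩)
    (hn ▸ (length_lt_prod_succ h).le)
  · rwa [hn] at this
  · have hd : a + 1 ∣ n := hn ▸ List.dvd_prod (List.mem_map_of_mem ha)
    exact (Nat.le_succ a).trans (Nat.le_of_dvd hn0 hd)

end Factorizations

/-! ### Finite checks on the table and admissible choices of primes. -/

section Table

instance : DecidableEq Entry := fun s t =>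
  decidable_of_iff (s.moduli = t.moduli ∧ s.exponents = t.exponents) (by
    cases s
    cases t
    simp)

theorem table_spec : ∀ k ∈ Finset.range 23, ∀ t ∈ table k, ∃ x ∈ smallTypes,
    t.moduli = typeModuli x ∧ x.2.2 * (t.exponents.map (· + 1)).prod = k ∧
      (∀ a ∈ t.exponents, 0 < a) ∧ t.exponents.Pairwise (· ≥ ·) := by
  decide +kernel

theorem table_complete : ∀ k ∈ Finset.range 23, ∀ x ∈ smallTypes, x.2.2 ∣ k → 0 < k →
    ∀ l ∈ exponentLists (k / x.2.2) (k / x.2.2) (k / x.2.2), ⟨typeModuli x, l⟩ ∈ table k := by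
  decide +kernel

/-- Order and number of subgroups separate the groups of the list, so uniqueness of elementary
divisors is not needed. -/
theorem typeModuli_eq_of_card_eq : ∀ x ∈ smallTypes, ∀ y ∈ smallTypes, x.2.2 = y.2.2 →
    (typeModuli x).prod = (typeModuli y).prod → typeModuli x = typeModuli y := by
  decide +kernel

theorem table_nodup : ∀ k ∈ Finset.range 23, (table k).Nodup := by
  decide +kernel

theorem length_table : ∀ k ∈ Finset.range 23, (table k).length = classCount k := by
  decide +kernel

theorem pos_of_mem_typeModuli {x : ℕ × List ℕ × ℕ} (hx : x ∈ smallTypes) {m : ℕ}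
    (hm : m ∈ typeModuli x) : 0 < m := by
  have key : ∀ x ∈ smallTypes, ∀ m ∈ typeModuli x, 0 < m := by decide +kernel
  exact key x hx m hm

theorem card_piZMod (l : List ℕ) : Nat.card (PiZMod l) = l.prod := by
  rw [Nat.card_pi]
  simp only [Nat.card_zmod]
  rw [← List.prod_ofFn, List.ofFn_get]

variable {t : Entry} {p : Fin t.exponents.length → ℕ}

theorem exists_admissible (h : ∀ m ∈ t.moduli, 0 < m) : ∃ p, t.Admissible p := by
  -- Primes beyond the sum of the moduli exceed each modulus, hence are coprime to it.
  let f := (Nat.infinite_setOfPred_prime.sdiff (Set.finite_Iic t.moduli.sum)).natEmbedding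
  refine ⟨fun i => f i, fun i => (f i).2.1, fun i j hij => ?_, fun i m hm => ?_⟩
  · exact Fin.ext (f.injective (Subtype.ext hij))
  · have h1 : t.moduli.sum < f i := not_le.1 (f i).2.2
    exact Nat.coprime_of_lt_prime (h m hm).ne' ((List.le_sum_of_mem hm).trans_lt h1) (f i).2.1

/-- The factorization of the group of an entry into its fixed and its arbitrary part. -/
def Entry.repEquiv (t : Entry) (p : Fin t.exponents.length → ℕ) :
    t.Rep p ≃* Multiplicative (PiZMod t.moduli) ×
      Multiplicative (ZMod (∏ i, p i ^ t.exponents.get i)) :=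
  MulEquiv.prodMultiplicative _ _

theorem prod_ne_zero_of_admissible (hp : t.Admissible p) : ∏ i, p i ^ t.exponents.get i ≠ 0 :=
  Finset.prod_ne_zero_iff.2 fun i _ => pow_ne_zero _ (hp.1 i).ne_zero

theorem coprime_of_admissible (hp : t.Admissible p) :
    (Nat.card (PiZMod t.moduli)).Coprime (∏ i, p i ^ t.exponents.get i) := by
  rw [Nat.card_pi]
  refine Nat.Coprime.prod_left fun j _ => Nat.Coprime.prod_right fun i _ => ?_
  rw [Nat.card_zmod]
  exact (hp.2.2 i _ (List.get_mem _ _)).symm.pow_right _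

theorem exponentMultiset_of_admissible (hp : t.Admissible p) (ht : ∀ a ∈ t.exponents, 0 < a) :
    exponentMultiset (∏ i, p i ^ t.exponents.get i) = t.exponents := by
  rw [exponentMultiset_prod_prime_pow hp.1 hp.2.1 fun i => ht _ (List.get_mem _ _),
    Fin.univ_val_map, List.ofFn_get]

end Table

/-! ### Similarity as an equivalence relation, and the classes in each row. -/

section Similarity

variable {G : Type u} [CommGroup G] {H : Type v} [CommGroup H]

theorem isSimilar_iff_of_zmod {A B : Type*} [AddCommGroup A] [AddCommGroup B] [Finite A] [Finite B]
    {m n : ℕ} (hm : m ≠ 0) (hn : n ≠ 0) (e : G ≃* Multiplicative A × Multiplicative (ZMod m))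
    (e' : H ≃* Multiplicative B × Multiplicative (ZMod n)) (hc : (Nat.card A).Coprime m)
    (hc' : (Nat.card B).Coprime n) (hA : NoCyclicSylow (Multiplicative A))
    (hB : NoCyclicSylow (Multiplicative B)) :
    IsSimilar G H ↔ Nonempty (A ≃+ B) ∧ exponentMultiset m = exponentMultiset n := by
  have : NeZero m := ⟨hm⟩
  have : NeZero n := ⟨hn⟩
  have hZ : ∀ k, Nat.card (Multiplicative (ZMod k)) = k := fun k =>
    (Nat.card_congr Multiplicative.toAdd).trans (Nat.card_zmod k)
  rw [isSimilar_iff e e' (by rwa [hZ, Nat.card_congr Multiplicative.toAdd])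
    (by rwa [hZ, Nat.card_congr Multiplicative.toAdd]) hA hB, hZ, hZ]
  exact and_congr_left' (Equiv.nonempty_congr AddEquiv.toMultiplicative.symm)

theorem isSimilar_refl [Finite G] : IsSimilar G G := by
  obtain ⟨ι, _, p, e, N, hp, he, hpair, hN, hc, ⟨E⟩⟩ := exists_decomposition G
  have : ∀ i, NeZero (p i ^ e i) := fun i => ⟨pow_ne_zero _ (hp i).ne_zero⟩
  have hM := noCyclicSylow_of_paired hp he hpair
  exact (isSimilar_iff_of_zmod hN hN E E hc hc hM hM).2 ⟨⟨AddEquiv.refl _⟩, rfl⟩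

theorem IsSimilar.symm [Finite G] [Finite H] (h : IsSimilar G H) : IsSimilar H G := by
  obtain ⟨ι, _, p, e, N, hp, he, hpair, hN, hc, ⟨E⟩⟩ := exists_decomposition G
  obtain ⟨ι', _, p', e', N', hp', he', hpair', hN', hc', ⟨E'⟩⟩ := exists_decomposition H
  have : ∀ i, NeZero (p i ^ e i) := fun i => ⟨pow_ne_zero _ (hp i).ne_zero⟩
  have : ∀ i, NeZero (p' i ^ e' i) := fun i => ⟨pow_ne_zero _ (hp' i).ne_zero⟩
  have hM := noCyclicSylow_of_paired hp he hpair
  have hM' := noCyclicSylow_of_paired hp' he' hpair'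
  obtain ⟨⟨a⟩, b⟩ := (isSimilar_iff_of_zmod hN hN' E E' hc hc' hM hM').1 h
  exact (isSimilar_iff_of_zmod hN' hN E' E hc' hc hM' hM).2 ⟨⟨a.symm⟩, b.symm⟩

theorem IsSimilar.trans {K : Type*} [CommGroup K] [Finite G] [Finite H] [Finite K]
    (h : IsSimilar G H) (h' : IsSimilar H K) : IsSimilar G K := by
  obtain ⟨ι, _, p, e, N, hp, he, hpair, hN, hc, ⟨E⟩⟩ := exists_decomposition G
  obtain ⟨ι', _, p', e', N', hp', he', hpair', hN', hc', ⟨E'⟩⟩ := exists_decomposition H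
  obtain ⟨ι₂, _, p₂, e₂, N₂, hp₂, he₂, hpair₂, hN₂, hc₂, ⟨E₂⟩⟩ := exists_decomposition K
  have : ∀ i, NeZero (p i ^ e i) := fun i => ⟨pow_ne_zero _ (hp i).ne_zero⟩
  have : ∀ i, NeZero (p' i ^ e' i) := fun i => ⟨pow_ne_zero _ (hp' i).ne_zero⟩
  have : ∀ i, NeZero (p₂ i ^ e₂ i) := fun i => ⟨pow_ne_zero _ (hp₂ i).ne_zero⟩
  have hM := noCyclicSylow_of_paired hp he hpair
  have hM' := noCyclicSylow_of_paired hp' he' hpair'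
  have hM₂ := noCyclicSylow_of_paired hp₂ he₂ hpair₂
  obtain ⟨⟨a⟩, b⟩ := (isSimilar_iff_of_zmod hN hN' E E' hc hc' hM hM').1 h
  obtain ⟨⟨a'⟩, b'⟩ := (isSimilar_iff_of_zmod hN' hN₂ E' E₂ hc' hc₂ hM' hM₂).1 h'
  exact (isSimilar_iff_of_zmod hN hN₂ E E₂ hc hc₂ hM hM₂).2 ⟨⟨a.trans a'⟩, b.trans b'⟩

/-- Similar finite abelian groups have the same number of subgroups. -/
theorem IsSimilar.card_subgroup_eq [Finite G] [Finite H] (h : IsSimilar G H) :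
    Nat.card (Subgroup G) = Nat.card (Subgroup H) := by
  obtain ⟨ι, _, p, e, N, hp, he, hpair, hN, hc, ⟨E⟩⟩ := exists_decomposition G
  obtain ⟨ι', _, p', e', N', hp', he', hpair', hN', hc', ⟨E'⟩⟩ := exists_decomposition H
  have : ∀ i, NeZero (p i ^ e i) := fun i => ⟨pow_ne_zero _ (hp i).ne_zero⟩
  have : ∀ i, NeZero (p' i ^ e' i) := fun i => ⟨pow_ne_zero _ (hp' i).ne_zero⟩
  have hM := noCyclicSylow_of_paired hp he hpair
  have hM' := noCyclicSylow_of_paired hp' he' hpair'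
  obtain ⟨⟨a⟩, b⟩ := (isSimilar_iff_of_zmod hN hN' E E' hc hc' hM hM').1 h
  rw [card_subgroup_of_decomposition hN hc E, card_subgroup_of_decomposition hN' hc' E',
    card_addSubgroup_congr a, b]

variable {k : ℕ} {s t : Entry}

theorem finite_piZMod (hk : k ≤ 22) (ht : t ∈ table k) : Finite (PiZMod t.moduli) := by
  obtain ⟨x, hx, hm, -⟩ := table_spec k (Finset.mem_range_succ_iff.2 hk) t ht
  have : ∀ j, NeZero (t.moduli.get j) := fun j =>
    ⟨(pos_of_mem_typeModuli hx (hm ▸ List.get_mem t.moduli j)).ne'⟩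
  exact inferInstance

theorem finite_rep (hk : k ≤ 22) (ht : t ∈ table k) {p : Fin t.exponents.length → ℕ}
    (hp : t.Admissible p) : Finite (t.Rep p) := by
  have := finite_piZMod hk ht
  have : NeZero (∏ i, p i ^ t.exponents.get i) := ⟨prod_ne_zero_of_admissible hp⟩
  exact Finite.of_equiv _ (t.repEquiv p).symm.toEquiv

theorem noCyclicSylow_moduli (hk : k ≤ 22) (ht : t ∈ table k) :
    NoCyclicSylow (Multiplicative (PiZMod t.moduli)) := by
  obtain ⟨x, hx, hm, -⟩ := table_spec k (Finset.mem_range_succ_iff.2 hk) t ht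
  rw [hm]
  exact noCyclicSylow_of_mem_smallTypes hx

theorem card_subgroup_rep (hk : k ≤ 22) (ht : t ∈ table k) {p : Fin t.exponents.length → ℕ}
    (hp : t.Admissible p) : Nat.card (Subgroup (t.Rep p)) = k := by
  obtain ⟨x, hx, hm, hx', ha, -⟩ := table_spec k (Finset.mem_range_succ_iff.2 hk) t ht
  have := finite_piZMod hk ht
  rw [card_subgroup_of_decomposition (prod_ne_zero_of_admissible hp) (coprime_of_admissible hp)
    (t.repEquiv p), exponentMultiset_of_admissible hp ha, Multiset.map_coe, Multiset.prod_coe,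
    ← hx', ← card_addSubgroup_of_mem_smallTypes hx, hm]

theorem isSimilar_rep_iff (hk : k ≤ 22) (hs : s ∈ table k) (ht : t ∈ table k)
    {p : Fin s.exponents.length → ℕ} {q : Fin t.exponents.length → ℕ} (hp : s.Admissible p)
    (hq : t.Admissible q) : IsSimilar (s.Rep p) (t.Rep q) ↔ s = t := by
  obtain ⟨x, hx, hm, -, ha, hd⟩ := table_spec k (Finset.mem_range_succ_iff.2 hk) s hs
  obtain ⟨y, hy, hm', -, ha', hd'⟩ := table_spec k (Finset.mem_range_succ_iff.2 hk) t ht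
  have := finite_piZMod hk hs
  have := finite_piZMod hk ht
  rw [isSimilar_iff_of_zmod (prod_ne_zero_of_admissible hp) (prod_ne_zero_of_admissible hq)
    (s.repEquiv p) (t.repEquiv q) (coprime_of_admissible hp) (coprime_of_admissible hq)
    (noCyclicSylow_moduli hk hs) (noCyclicSylow_moduli hk ht),
    exponentMultiset_of_admissible hp ha, exponentMultiset_of_admissible hq ha', Multiset.coe_eq_coe]
  constructor
  · rintro ⟨⟨E⟩, h⟩
    have h1 : s.moduli = t.moduli := by
      have hc := card_addSubgroup_congr E
      have hc' := Nat.card_congr E.toEquiv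
      rw [hm, hm', card_addSubgroup_of_mem_smallTypes hx,
        card_addSubgroup_of_mem_smallTypes hy] at hc
      rw [card_piZMod, card_piZMod, hm, hm'] at hc'
      rw [hm, hm', typeModuli_eq_of_card_eq x hx y hy hc hc']
    -- Weakly decreasing lists that are permutations of each other coincide.
    have h2 : s.exponents = t.exponents :=
      h.eq_of_pairwise (fun a b _ _ h h' => le_antisymm h' h) hd hd'
    cases s
    cases t
    simp_all
  · rintro rfl
    exact ⟨⟨AddEquiv.refl _⟩, List.Perm.refl _⟩

theorem exists_admissible_of_mem_table (hk : k ≤ 22) (ht : t ∈ table k) : ∃ p, t.Admissible p := by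
  obtain ⟨x, hx, hm, -⟩ := table_spec k (Finset.mem_range_succ_iff.2 hk) t ht
  exact exists_admissible fun m h => pos_of_mem_typeModuli hx (hm ▸ h)

/-- A finite abelian group with `k ≤ 22` subgroups belongs to a class in row `k`. -/
theorem exists_isSimilar_rep [Finite G] (hk : k ≤ 22) (h : Nat.card (Subgroup G) = k) :
    ∃ t ∈ table k, ∃ p, t.Admissible p ∧ IsSimilar G (t.Rep p) := by
  obtain ⟨ι, _, p, e, N, hp, he, hpair, hN, hc, ⟨E⟩⟩ := exists_decomposition G
  have : ∀ i, NeZero (p i ^ e i) := fun i => ⟨pow_ne_zero _ (hp i).ne_zero⟩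
  have hM := noCyclicSylow_of_paired hp he hpair
  rw [card_subgroup_of_decomposition hN hc E] at h
  let l := (exponentMultiset N).sort (· ≥ ·)
  have hl : (l : Multiset ℕ) = exponentMultiset N := Multiset.sort_eq _ _
  have hlpos : ∀ a ∈ l, 0 < a := fun a ha =>
    pos_of_mem_exponentMultiset (hl ▸ Multiset.mem_coe.2 ha)
  have hlsort : l.Pairwise (· ≥ ·) := Multiset.pairwise_sort _ _
  rw [← hl, Multiset.map_coe, Multiset.prod_coe] at h
  have hprod : 0 < (l.map (· + 1)).prod := (Nat.zero_le _).trans_lt (length_lt_prod_succ hlpos)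
  -- The factor coming from the cyclic part is positive, so the other part also has at most `22`
  -- subgroups.
  obtain ⟨x, hx, ⟨F⟩⟩ := exists_mem_smallTypes hp he hpair
    ((Nat.le_mul_of_pos_right _ hprod).trans (h.le.trans hk))
  have hcx : 0 < x.2.2 := by
    rw [← card_addSubgroup_of_mem_smallTypes hx, ← card_addSubgroup_congr F]
    exact Nat.card_pos
  rw [card_addSubgroup_congr F, card_addSubgroup_of_mem_smallTypes hx] at h
  have ht : ⟨typeModuli x, l⟩ ∈ table k := by
    refine table_complete k (Finset.mem_range_succ_iff.2 hk) x hx (Dvd.intro _ h)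
      (h ▸ Nat.mul_pos hcx hprod) l (mem_exponentLists_self hlsort hlpos ?_)
    rw [← h, Nat.mul_div_cancel_left _ hcx]
  obtain ⟨q, hq⟩ := exists_admissible_of_mem_table hk ht
  have := finite_piZMod hk ht
  refine ⟨_, ht, q, hq, ?_⟩
  rw [isSimilar_iff_of_zmod hN (prod_ne_zero_of_admissible hq) E (Entry.repEquiv _ q) hc
    (coprime_of_admissible hq) hM (noCyclicSylow_moduli hk ht),
    exponentMultiset_of_admissible hq hlpos]
  exact ⟨⟨F⟩, hl.symm⟩

theorem card_subgroup_eq_iff (hk1 : 1 ≤ k) (hk : k ≤ 22) :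
    Nat.card (Subgroup G) = k ↔
      Finite G ∧ ∃ t ∈ table k, ∃ p, t.Admissible p ∧ IsSimilar G (t.Rep p) := by
  constructor
  · intro h
    -- `Nat.card` is `0` on infinite types, so `1 ≤ k` is what yields finiteness here.
    have : Finite (Subgroup G) := Nat.finite_of_card_ne_zero (by omega)
    have := finite_of_finite_subgroup G
    exact ⟨this, exists_isSimilar_rep hk h⟩
  · rintro ⟨_, t, ht, p, hp, h⟩
    have := finite_rep hk ht hp
    rw [h.card_subgroup_eq, card_subgroup_rep hk ht hp]

theorem ncard_similarityClasses (hk : k ≤ 22) :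
    (similarityClasses k).ncard = (table k).length := by
  classical
  have hadm : ∀ t : {t // t ∈ table k}, ∃ p, t.1.Admissible p := fun t =>
    exists_admissible_of_mem_table hk t.2
  choose p hp using hadm
  have hfin : ∀ t : {t // t ∈ table k}, Finite (t.1.Rep (p t)) := fun t => finite_rep hk t.2 (hp t)
  let R : {t // t ∈ table k} → FinAbGroupWith k := fun t =>
    ⟨t.1.Rep (p t), card_subgroup_rep hk t.2 (hp t)⟩
  let F : {t // t ∈ table k} → Set (FinAbGroupWith k) := fun t =>
    {H | IsSimilar (R t).carrier H.carrier}
  have hF : Function.Injective F := by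
    intro s t h
    -- Each representative lies in its own class, so equal classes have similar representatives.
    have hmem : R t ∈ F t := isSimilar_refl (G := (R t).carrier)
    rw [← h] at hmem
    exact Subtype.ext ((isSimilar_rep_iff hk s.2 t.2 (hp s) (hp t)).1 hmem)
  have hrange : similarityClasses k = Set.range F := by
    ext C
    constructor
    · rintro ⟨G, rfl⟩
      obtain ⟨t, ht, q, hq, h⟩ := exists_isSimilar_rep hk G.card_subgroup
      have := finite_rep hk ht hq
      have h1 : IsSimilar (t.Rep q) (R ⟨t, ht⟩).carrier :=
        (isSimilar_rep_iff hk ht ht hq (hp ⟨t, ht⟩)).2 rfl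
      have h2 : IsSimilar G.carrier (R ⟨t, ht⟩).carrier := h.trans h1
      exact ⟨⟨t, ht⟩, Set.ext fun H => ⟨fun h' => h2.trans h', fun h' => h2.symm.trans h'⟩⟩
    · rintro ⟨t, rfl⟩
      exact ⟨R t, rfl⟩
  rw [hrange, ← Set.image_univ, Set.ncard_image_of_injective _ hF, Set.ncard_univ,
    Nat.card_eq_fintype_card, Fintype.card_of_subtype (table k).toFinset fun t => List.mem_toFinset,
    List.toFinset_card_of_nodup (table_nodup k (Finset.mem_range_succ_iff.2 hk))]

end Similarity

end SubgroupCount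

theorem mainTheorem2 (k : ℕ) (hk : 1 ≤ k) (hk' : k ≤ 22) :
    -- every group listed in row `k` has exactly `k` subgroups
    (∀ t ∈ SubgroupCount.table k,
      (∃ p, t.Admissible p) ∧
      ∀ p, t.Admissible p → Nat.card (Subgroup (t.Rep p)) = k) ∧
    -- each entry is a single similarity class, and distinct entries are distinct classes
    (∀ s ∈ SubgroupCount.table k, ∀ t ∈ SubgroupCount.table k,
      ∀ p q, s.Admissible p → t.Admissible q →
        (SubgroupCount.IsSimilar (s.Rep p) (t.Rep q) ↔ s = t)) ∧
    -- an abelian group has exactly `k` subgroups iff it is finite and in a class listed in row `k`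
    (∀ (G : Type*) [CommGroup G],
      Nat.card (Subgroup G) = k ↔
        Finite G ∧ ∃ t ∈ SubgroupCount.table k, ∃ p, t.Admissible p ∧
          SubgroupCount.IsSimilar G (t.Rep p)) ∧
    -- the number of similarity classes
    (SubgroupCount.table k).length = SubgroupCount.classCount k ∧
    (SubgroupCount.similarityClasses k).ncard = SubgroupCount.classCount k := by
  have hk23 := Finset.mem_range_succ_iff.2 hk'
  have hlen := SubgroupCount.length_table k hk23
  refine ⟨fun t ht => ⟨SubgroupCount.exists_admissible_of_mem_table hk' ht,
    fun p hp => SubgroupCount.card_subgroup_rep hk' ht hp⟩, ?_, ?_, hlen, ?_⟩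
  · intro s hs t ht p q hp hq
    exact SubgroupCount.isSimilar_rep_iff hk' hs ht hp hq
  · intro G _
    exact SubgroupCount.card_subgroup_eq_iff hk hk'
  · rw [SubgroupCount.ncard_similarityClasses hk', hlen]
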